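/- Let $N,d\in\mathbb N$ and $\mathbb T^d=\mathbb R^d/\mathbb Z^d$. For $i=1,\dots,N$ let $L^i\in C^2(\mathbb T^d\times\mathbb R^d)$ be real-valued and suppose that for some $C_0\ge 1$ and all $i$, $x$, $v$ $$D^2_{v}L^i(x,v)\ge \tfrac1{C_0}\,\mathrm{Id},\qquad \tfrac1{C_0}(1+|v|^2)\le L^i(x,v)\le C_0(1+|v|^2),$$ and let $F^i:(\mathbb T^d)^N\to\mathbb R$ be continuous. Put $H^i(x,p)=\sup_{v\in\mathbb R^d}\{\langle p,v\rangle-L^i(x,v)\}$ and, for Borel probability measures $m_1,\dots,m_N$ on $\mathbb T^d$, $$V^i[m_1,\dots,m_N](y)=\int_{(\mathbb T^d)^{N-1}}F^i(x_1,\dots,x_{i-1},y,x_{i+1},\dots,x_N)\prod_{j\ne i}m_j(dx_j).$$ Let $\pi(x,v)=x$. For profiles $\mu=(\mu_j)_{j=1}^N$ and $\eta=(\eta^j)_{j=1}^N$ of Borel probability measures on $\mathbb T^d\times\mathbb R^d$ the payoff of player $i$ is $$J^i(\mu,\eta)=\int_{\mathbb T^d\times\mathbb R^d}\bigl(L^i(x,v)+V^i[\pi\sharp\mu_1,\dots,\pi\sharp\mu_N](x)\bigr)\,\eta^i(dx,dv)\in(-\infty,+\infty].$$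 Given $\mu$, let $\Phi^i_t$ denote the Euler flow of $\mathcal L^i(x,v)=L^i(x,v)+V^i[\pi\sharp\mu_1,\dots,\pi\sharp\mu_N](x)$. That is, $\mathcal L^i$ is $C^1$, every initial condition $(x_0,v_0)$ has a unique $C^1$ solution $x:\mathbb R\to\mathbb T^d$ of $\frac{d}{dt}D_v\mathcal L^i(x,\dot x)=D_x\mathcal L^i(x,\dot x)$, $x(0)=x_0$, $\dot x(0)=v_0$, and $\Phi^i_t(x_0,v_0)=(x(t),\dot x(t))$ is continuous in $(t,x_0,v_0)$. A measure is invariant for $\Phi^i_t$ if this flow exists and preserves the measure for every $t\in\mathbb R$. The profile $\overline\mu=(\overline\mu_j)_{j=1}^N$ is a Nash equilibrium in mixed strategies if, with the flows $\Phi^i_t$ defined by $\overline\mu$, each $\overline\mu_i$ is invariant for $\Phi^i_t$, and for every $i$ and every Borel probability measure $\nu$ on $\mathbb T^d\times\mathbb R^d$ invariant for $\Phi^i_t$, $J^i(\overline\mu,\overline\mu)\le J^i(\overline\mu,((\overline\mu_j)_{j\ne i},\nu))$. Let $\overline\mu$ be a Nash equilibrium in mixed strategies. Then for every $i$ there is exactly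 one constant $\lambda_i\in\mathbb R$ (the ergodic constant of player $i$) such that $$H^i(x,Dz(x))+\lambda_i=V^i[\pi\sharp\overline\mu_1,\dots,\pi\sharp\overline\mu_N](x),\qquad x\in\mathbb T^d,$$ has a continuous viscosity solution $z:\mathbb T^d\to\mathbb R$, and $$J^i(\overline\mu,\overline\mu)=\lambda_i .$$ -/

import Mathlib

open MeasureTheory Set
open scoped ENNReal

noncomputable section

namespace ErgodicGame

/-- Euclidean space `ℝ^d`. -/
abbrev E (d : ℕ) : Type := EuclideanSpace ℝ (Fin d)

/-- The flat torus `𝕋^d = ℝ^d / ℤ^d`. -/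
abbrev Torus (d : ℕ) : Type := UnitAddTorus (Fin d)

/-- The phase space `𝕋^d × ℝ^d`. -/
abbrev Phase (d : ℕ) : Type := Torus d × E d

/-- The covering projection `ℝ^d → 𝕋^d`. Derivatives of functions on the torus are computed on
their periodic lifts along this map. -/
def proj {d : ℕ} (x : E d) : Torus d := fun k => (x k : UnitAddCircle)

/-- The standing assumptions on the Lagrangians: each `L^i` is of class `C²` on `𝕋^d × ℝ^d`,
uniformly convex in the velocity, and bounded above and below by quadratic functions of it. -/
structure LagrangianAssumptions {N d : ℕ} (L : Fin N → Torus d → E d → ℝ) : Prop where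
  contDiff : ∀ i, ContDiff ℝ 2 (fun q : E d × E d => L i (proj q.1) q.2)
  bounds : ∃ C₀ : ℝ, 1 ≤ C₀ ∧ ∀ (i : Fin N) (x : Torus d) (v : E d),
    (∀ w : E d, 1 / C₀ * ‖w‖ ^ 2 ≤ fderiv ℝ (fderiv ℝ (L i x)) v w w) ∧
    1 / C₀ * (1 + ‖v‖ ^ 2) ≤ L i x v ∧ L i x v ≤ C₀ * (1 + ‖v‖ ^ 2)

/-- The Hamiltonian `H(x,p) = sup_v {⟨p,v⟩ - L(x,v)}`. -/
def hamiltonian {d : ℕ} (L : Torus d → E d → ℝ) (x : Torus d) (p : E d) : ℝ :=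
  ⨆ v : E d, (inner ℝ p v - L x v)

/-- `x : ℝ → ℝ^d` is (a lift of) a global solution of the Euler-Lagrange equation
`d/dt D_v L(x, ẋ) = D_x L(x, ẋ)`. -/
def IsExtremal {d : ℕ} (L : Torus d → E d → ℝ) (x : ℝ → E d) : Prop :=
  ContDiff ℝ 1 x ∧ ∀ t : ℝ,
    HasDerivAt (fun s => fderiv ℝ (L (proj (x s))) (deriv x s))
      (fderiv ℝ (fun y => L (proj y) (deriv x t)) (x t)) t

/-- `Φ` is the Euler flow of `L`: every initial condition `(x₀, v₀)` has a global solution `x` of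
the Euler-Lagrange equation, it is unique, `Φ_t(x₀, v₀) = (x(t), ẋ(t))`, and the flow is
continuous. There is at most one such `Φ`. -/
structure IsEulerFlow {d : ℕ} (L : Torus d → E d → ℝ) (Φ : ℝ → Phase d → Phase d) : Prop where
  contDiff : ContDiff ℝ 1 (fun q : E d × E d => L (proj q.1) q.2)
  exists_extremal : ∀ x₀ v₀ : E d, ∃ x : ℝ → E d, IsExtremal L x ∧ x 0 = x₀ ∧ deriv x 0 = v₀
  eq_extremal : ∀ x : ℝ → E d, IsExtremal L x → ∀ t : ℝ,
    Φ t (proj (x 0), deriv x 0) = (proj (x t), deriv x t)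
  continuous : Continuous (fun p : ℝ × Phase d => Φ p.1 p.2)

/-- A Borel probability measure on `𝕋^d × ℝ^d` which is invariant for the Euler flow of `L`. -/
def IsEulerInvariant {d : ℕ} (L : Torus d → E d → ℝ) (η : ProbabilityMeasure (Phase d)) : Prop :=
  ∃ Φ : ℝ → Phase d → Phase d, IsEulerFlow L Φ ∧
    ∀ t : ℝ, MeasurePreserving (Φ t) (η : Measure (Phase d)) (η : Measure (Phase d))

/-- The image `π♯η` of `η` under `π(x,v) = x`. -/
def marginal {d : ℕ} (η : ProbabilityMeasure (Phase d)) : ProbabilityMeasure (Torus d) :=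
  η.map measurable_fst.aemeasurable

/-- The averaged coupling `V^i[m_1, …, m_N](y)`: the integral of
`F^i(x_1, …, x_{i-1}, y, x_{i+1}, …, x_N)` against `∏_{j ≠ i} m_j(dx_j)`. -/
def meanCoupling {N d : ℕ} (F : Fin N → (Fin N → Torus d) → ℝ) (i : Fin N)
    (m : Fin N → ProbabilityMeasure (Torus d)) (y : Torus d) : ℝ :=
  ∫ x : {j : Fin N // j ≠ i} → Torus d,
    F i (fun j => if h : j = i then y else x ⟨j, h⟩)
      ∂(Measure.pi fun j : {j : Fin N // j ≠ i} => (m j : Measure (Torus d)))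

/-- The Lagrangian `L^i(x,v) + V^i[m_1, …, m_N](x)` of player `i`. -/
def playerLagrangian {N d : ℕ} (L : Fin N → Torus d → E d → ℝ)
    (F : Fin N → (Fin N → Torus d) → ℝ) (m : Fin N → ProbabilityMeasure (Torus d))
    (i : Fin N) (x : Torus d) (v : E d) : ℝ :=
  L i x v + meanCoupling F i m x

/-- The integral `∫ f⁺ - ∫ f⁻` with values in `[-∞, ∞]`; for `f` bounded below and `η` a
probability measure it is the usual integral with values in `(-∞, ∞]`. -/
def extIntegral {α : Type*} [MeasurableSpace α] (f : α → ℝ) (η : Measure α) : EReal :=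
  ((∫⁻ a, ENNReal.ofReal (f a) ∂η : ℝ≥0∞) : EReal) -
    ((∫⁻ a, ENNReal.ofReal (-f a) ∂η : ℝ≥0∞) : EReal)

/-- The payoff
`J^i((μ_j), (η^j)) = ∫ (L^i(x,v) + V^i[π♯μ_1, …, π♯μ_N](x)) η^i(dx, dv)`. -/
def payoff {N d : ℕ} (L : Fin N → Torus d → E d → ℝ) (F : Fin N → (Fin N → Torus d) → ℝ)
    (i : Fin N) (μ η : Fin N → ProbabilityMeasure (Phase d)) : EReal :=
  extIntegral (fun z : Phase d => playerLagrangian L F (fun j => marginal (μ j)) i z.1 z.2)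
    (η i : Measure (Phase d))

/-- Nash equilibria in mixed strategies. -/
def IsMixedNash {N d : ℕ} (L : Fin N → Torus d → E d → ℝ) (F : Fin N → (Fin N → Torus d) → ℝ)
    (μ : Fin N → ProbabilityMeasure (Phase d)) : Prop :=
  (∀ i, IsEulerInvariant (playerLagrangian L F (fun j => marginal (μ j)) i) (μ i)) ∧
  ∀ (i : Fin N) (ν : ProbabilityMeasure (Phase d)),
    IsEulerInvariant (playerLagrangian L F (fun j => marginal (μ j)) i) ν →
      payoff L F i μ μ ≤ payoff L F i μ (Function.update μ i ν)

/-- Viscosity solutions `u : 𝕋^d → ℝ` of `G(x, Du(x)) = f(x)`. -/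
def IsViscositySolution {d : ℕ} (G : Torus d → E d → ℝ) (f u : Torus d → ℝ) : Prop :=
  (∀ φ : Torus d → ℝ, ContDiff ℝ 1 (fun y : E d => φ (proj y)) → ∀ x : E d,
    IsLocalMax (fun z => u z - φ z) (proj x) →
      G (proj x) (gradient (fun y : E d => φ (proj y)) x) ≤ f (proj x)) ∧
  (∀ ψ : Torus d → ℝ, ContDiff ℝ 1 (fun y : E d => ψ (proj y)) → ∀ x : E d,
    IsLocalMin (fun z => u z - ψ z) (proj x) →
      f (proj x) ≤ G (proj x) (gradient (fun y : E d => ψ (proj y)) x))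

/-- `lam` is an ergodic constant of player `i` at the profile `m`: the ergodic Hamilton-Jacobi
equation `H^i(x, Dz(x)) + lam = V^i[m_1, …, m_N](x)` has a continuous viscosity solution `z` on
the torus. -/
def IsErgodicConstant {N d : ℕ} (L : Fin N → Torus d → E d → ℝ)
    (F : Fin N → (Fin N → Torus d) → ℝ) (m : Fin N → ProbabilityMeasure (Torus d))
    (i : Fin N) (lam : ℝ) : Prop :=
  ∃ z : Torus d → ℝ, Continuous z ∧
    IsViscositySolution (fun x p => hamiltonian (L i) x p + lam) (meanCoupling F i m) z

end ErgodicGame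

end

/-!
Fix a player and write `ℓ(x, v) = L(x, v) + V(x)` for the Lagrangian that the other players'
measures induce. The assertion is that there is exactly one `lam` for which `H_ℓ(x, Du) = -lam` has a
viscosity solution, and that `lam` is the minimum of `∫ ℓ dν` over the measures `ν` invariant under
the Euler flow; the Nash property says that the player's own measure attains this minimum.

Existence, the lower bound and a minimizing measure all come from one construction. With time step
`h` and discount factor `1 - h²`, the Bellman operator is a contraction
(`exists_discounted_value`); its fixed point, normalized, solves the ergodic problem up to `O(h²)`
per step, with bounds uniform in `h` (`exists_discreteCorrector`). Two consecutive optimal steps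
satisfy a discrete Euler-Lagrange equation (`discrete_euler_lagrange`), so the momenta along
optimal chains vary at bounded speed, and strong convexity makes the velocities equicontinuous.
As `h → 0` along an ultrafilter, the fixed points converge to a Lipschitz function `u`, and optimal
chains converge to curves of class `C¹` which are extremals and along which `u` has derivative
`ℓ - lam` (`IsDiscreteApproximation.exists_calibrated_curve`). This way extremals calibrated by `u`
are found without existence and regularity theory for minimizers of the action.

* The function `u` is dominated by the action of short segments, which gives the subsolution
  property; testing along a calibrated curve that ends at a given point gives the supersolution
  property (`IsDiscreteApproximation.isViscositySolution`).
* Doubling of variables shows that `lam` is unique (`ergodic_comparison`).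
* Integrating the domination along extremals against an invariant measure gives `lam ≤ ∫ ℓ dν`
  (`IsDiscreteApproximation.le_extIntegral`).
* Time averages along a calibrated extremal defined on all of `ℝ` converge to an invariant measure
  of action `lam` (`IsDiscreteApproximation.exists_minimizing_measure`).
-/

open Filter Topology

noncomputable section

namespace ErgodicGame

variable {d : ℕ}

/-! ### The covering of the torus -/

lemma proj_add (x y : E d) : proj (x + y) = proj x + proj y := by
  funext k; simp [proj]

lemma proj_sub (x y : E d) : proj (x - y) = proj x - proj y := by
  funext k; simp [proj]

lemma proj_zero : proj (0 : E d) = 0 := by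
  funext k; simp [proj]

lemma isOpenQuotientMap_proj : IsOpenQuotientMap (proj : E d → Torus d) := by
  have h1 : IsOpenQuotientMap (Pi.map fun (_ : Fin d) (r : ℝ) => (r : UnitAddCircle)) :=
    IsOpenQuotientMap.piMap fun _ => QuotientAddGroup.isOpenQuotientMap_mk
  exact h1.comp (PiLp.homeomorph 2 (fun _ : Fin d => ℝ)).isOpenQuotientMap

lemma continuous_proj : Continuous (proj : E d → Torus d) := isOpenQuotientMap_proj.continuous

lemma proj_surjective : Function.Surjective (proj : E d → Torus d) :=
  isOpenQuotientMap_proj.surjective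

/-- Every point of `ℝ^d` is a lattice vector plus a vector of norm at most `√d`. -/
lemma exists_lattice_translate (y : E d) :
    ∃ e : E d, proj e = 0 ∧ ‖y - e‖ ≤ Real.sqrt d := by
  refine ⟨WithLp.toLp 2 fun k => (⌊y k⌋ : ℝ), ?_, ?_⟩
  · funext k
    simp [proj]
  · rw [EuclideanSpace.norm_eq]
    refine Real.sqrt_le_sqrt ?_
    calc ∑ k : Fin d, ‖(y - WithLp.toLp 2 fun k => (⌊y k⌋ : ℝ)) k‖ ^ 2
        ≤ ∑ _k : Fin d, (1 : ℝ) := by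
          refine Finset.sum_le_sum fun k _ => ?_
          have h0 := Int.fract_nonneg (y k)
          have h1 := Int.fract_lt_one (y k)
          have : (y - WithLp.toLp 2 fun k => (⌊y k⌋ : ℝ)) k = Int.fract (y k) := by
            simp
          rw [this, Real.norm_eq_abs, abs_of_nonneg h0]
          nlinarith
      _ = d := by simp

lemma exists_small_lift (x : Torus d) : ∃ y : E d, proj y = x ∧ ‖y‖ ≤ Real.sqrt d := by
  obtain ⟨y, rfl⟩ := proj_surjective x
  obtain ⟨e, he, hb⟩ := exists_lattice_translate y
  exact ⟨y - e, by rw [proj_sub, he, sub_zero], hb⟩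

/-- A function on `ℝ^d × ℝ^d` which is periodic in the first variable. -/
def IsPeriodicFst {F : Type*} (f : E d × E d → F) : Prop :=
  ∀ e y v : E d, proj e = 0 → f (y - e, v) = f (y, v)

lemma IsPeriodicFst.bounded {F : Type*} [NormedAddCommGroup F] {f : E d × E d → F}
    (hp : IsPeriodicFst f) (hf : Continuous f) (R : ℝ) :
    ∃ B : ℝ, ∀ y v : E d, ‖v‖ ≤ R → ‖f (y, v)‖ ≤ B := by
  obtain ⟨B, hB⟩ := ((isCompact_closedBall (0 : E d) (Real.sqrt d)).prod
    (isCompact_closedBall (0 : E d) R)).exists_bound_of_continuousOn hf.continuousOn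
  refine ⟨B, fun y v hv => ?_⟩
  obtain ⟨e, he, hb⟩ := exists_lattice_translate y
  rw [← hp e y v he]
  exact hB _ ⟨by simpa using hb, by simpa using hv⟩

/-- A continuous function on `ℝ^d × ℝ^d`, periodic in the first variable, is uniformly continuous
on `ℝ^d × B` for every ball `B`. -/
lemma IsPeriodicFst.uniform {F : Type*} [NormedAddCommGroup F] {f : E d × E d → F}
    (hp : IsPeriodicFst f) (hf : Continuous f) (R : ℝ) {ε : ℝ} (hε : 0 < ε) :
    ∃ δ > 0, ∀ y y' v v' : E d, ‖v‖ ≤ R → ‖v'‖ ≤ R → ‖y - y'‖ ≤ δ → ‖v - v'‖ ≤ δ →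
      ‖f (y, v) - f (y', v')‖ ≤ ε := by
  have hK := (isCompact_closedBall (0 : E d) (Real.sqrt d + 1)).prod
    (isCompact_closedBall (0 : E d) R)
  have hu := hK.uniformContinuousOn_of_continuous hf.continuousOn
  obtain ⟨δ, hδ, H⟩ := Metric.uniformContinuousOn_iff.1 hu ε hε
  refine ⟨min (δ / 2) 1, by positivity, fun y y' v v' hv hv' h1 h2 => ?_⟩
  obtain ⟨e, he, hb⟩ := exists_lattice_translate y
  rw [← hp e y v he, ← hp e y' v' he, ← dist_eq_norm]
  have h1' : ‖y - y'‖ ≤ 1 := h1.trans (min_le_right _ _)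
  refine (H (y - e, v) ⟨?_, by simpa using hv⟩ (y' - e, v') ⟨?_, by simpa using hv'⟩ ?_).le
  · simpa using hb.trans (by linarith)
  · have : y' - e = (y - e) - (y - y') := by abel
    simp only [mem_closedBall_zero_iff, this]
    exact (norm_sub_le _ _).trans (by linarith)
  · rw [Prod.dist_eq, max_lt_iff]
    have h1' : ‖y - y'‖ ≤ δ / 2 := h1.trans (min_le_left _ _)
    have h2' : ‖v - v'‖ ≤ δ / 2 := h2.trans (min_le_left _ _)
    simp only [dist_eq_norm, sub_sub_sub_cancel_right]
    constructor <;> linarith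

/-! ### Lagrangians on the torus -/

/-- The properties of the Lagrangian `L + V` of a single player that the argument uses: it is of
class `C¹` on the universal cover, bounded below by `c|v|² - A`, and its velocity derivative is
strongly monotone with modulus `c`. -/
structure IsConvexLagrangian (c A : ℝ) (ℓ : Torus d → E d → ℝ) : Prop where
  pos : 0 < c
  contDiff : ContDiff ℝ 1 (fun q : E d × E d => ℓ (proj q.1) q.2)
  lower : ∀ x v, c * ‖v‖ ^ 2 - A ≤ ℓ x v
  monotone : ∀ x v w, c * ‖v - w‖ ^ 2 ≤ (fderiv ℝ (ℓ x) v - fderiv ℝ (ℓ x) w) (v - w)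

/-- The momentum `D_v ℓ(y, v)`. -/
def momentum (ℓ : Torus d → E d → ℝ) (q : E d × E d) : E d →L[ℝ] ℝ :=
  fderiv ℝ (ℓ (proj q.1)) q.2

/-- The force `D_x ℓ(y, v)`. -/
def force (ℓ : Torus d → E d → ℝ) (q : E d × E d) : E d →L[ℝ] ℝ :=
  fderiv ℝ (fun y => ℓ (proj y) q.2) q.1

/-- The lift of `ℓ` to the universal cover. -/
def liftL (ℓ : Torus d → E d → ℝ) (q : E d × E d) : ℝ := ℓ (proj q.1) q.2

lemma isPeriodicFst_liftL (ℓ : Torus d → E d → ℝ) : IsPeriodicFst (liftL ℓ) := by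
  intro e y v he
  simp [liftL, proj_sub, he]

lemma isPeriodicFst_momentum (ℓ : Torus d → E d → ℝ) : IsPeriodicFst (momentum ℓ) := by
  intro e y v he
  simp [momentum, proj_sub, he]

lemma isPeriodicFst_force (ℓ : Torus d → E d → ℝ) : IsPeriodicFst (force ℓ) := by
  intro e y v he
  have : (fun z => ℓ (proj z) v) = fun z => (fun y => ℓ (proj y) v) (z - e) := by
    funext z; simp [proj_sub, he]
  simp only [force]
  rw [← fderiv_comp_sub (f := fun y => ℓ (proj y) v), ← this]

namespace IsConvexLagrangian

variable {c A : ℝ} {ℓ : Torus d → E d → ℝ}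

lemma continuous_liftL (h : IsConvexLagrangian c A ℓ) : Continuous (liftL ℓ) :=
  h.contDiff.continuous

lemma hasFDerivAt_liftL (h : IsConvexLagrangian c A ℓ) (q : E d × E d) :
    HasFDerivAt (liftL ℓ) (fderiv ℝ (liftL ℓ) q) q :=
  (h.contDiff.differentiable one_ne_zero q).hasFDerivAt

lemma hasFDerivAt_snd (h : IsConvexLagrangian c A ℓ) (q : E d × E d) :
    HasFDerivAt (ℓ (proj q.1)) ((fderiv ℝ (liftL ℓ) q).comp (ContinuousLinearMap.inr ℝ _ _)) q.2 :=
  (h.hasFDerivAt_liftL q).comp q.2 (f := fun v => (q.1, v)) (hasFDerivAt_prodMk_right q.1 q.2)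

lemma hasFDerivAt_fst (h : IsConvexLagrangian c A ℓ) (q : E d × E d) :
    HasFDerivAt (fun y => ℓ (proj y) q.2)
      ((fderiv ℝ (liftL ℓ) q).comp (ContinuousLinearMap.inl ℝ _ _)) q.1 :=
  (h.hasFDerivAt_liftL q).comp q.1 (f := fun y => (y, q.2)) (hasFDerivAt_prodMk_left q.1 q.2)

lemma momentum_eq (h : IsConvexLagrangian c A ℓ) (q : E d × E d) :
    momentum ℓ q = (fderiv ℝ (liftL ℓ) q).comp (ContinuousLinearMap.inr ℝ _ _) :=
  (h.hasFDerivAt_snd q).fderiv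

lemma force_eq (h : IsConvexLagrangian c A ℓ) (q : E d × E d) :
    force ℓ q = (fderiv ℝ (liftL ℓ) q).comp (ContinuousLinearMap.inl ℝ _ _) :=
  (h.hasFDerivAt_fst q).fderiv

lemma continuous_fderiv_liftL (h : IsConvexLagrangian c A ℓ) :
    Continuous (fderiv ℝ (liftL ℓ)) := h.contDiff.continuous_fderiv one_ne_zero

lemma continuous_momentum (h : IsConvexLagrangian c A ℓ) : Continuous (momentum ℓ) := by
  rw [funext h.momentum_eq]
  exact h.continuous_fderiv_liftL.clm_comp continuous_const

lemma continuous_force (h : IsConvexLagrangian c A ℓ) : Continuous (force ℓ) := by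
  rw [funext h.force_eq]
  exact h.continuous_fderiv_liftL.clm_comp continuous_const

lemma hasFDerivAt_momentum_force (h : IsConvexLagrangian c A ℓ) (q : E d × E d) :
    HasFDerivAt (liftL ℓ) ((force ℓ q).coprod (momentum ℓ q)) q := by
  have : (force ℓ q).coprod (momentum ℓ q) = fderiv ℝ (liftL ℓ) q := by
    rw [h.momentum_eq, h.force_eq]
    ext w <;> simp
  rw [this]
  exact h.hasFDerivAt_liftL q

lemma continuous_uncurry (h : IsConvexLagrangian c A ℓ) :
    Continuous (fun z : Torus d × E d => ℓ z.1 z.2) := by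
  have hq : IsOpenQuotientMap (Prod.map (proj : E d → Torus d) (id : E d → E d)) :=
    isOpenQuotientMap_proj.prodMap IsOpenQuotientMap.id
  exact hq.isQuotientMap.continuous_iff.2 h.continuous_liftL

/-- The Lagrangian is bounded on bounded sets of velocities. -/
lemma exists_abs_le (h : IsConvexLagrangian c A ℓ) (R : ℝ) :
    ∃ B : ℝ, ∀ x v, ‖v‖ ≤ R → |ℓ x v| ≤ B := by
  obtain ⟨B, hB⟩ := (isPeriodicFst_liftL ℓ).bounded h.continuous_liftL R
  refine ⟨B, fun x v hv => ?_⟩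
  obtain ⟨y, rfl⟩ := proj_surjective x
  exact hB y v hv

/-- The velocity is controlled by the momentum, at a fixed point of the torus. -/
lemma norm_sub_le_momentum (h : IsConvexLagrangian c A ℓ) (y v w : E d) :
    c * ‖v - w‖ ≤ ‖momentum ℓ (y, v) - momentum ℓ (y, w)‖ := by
  have h1 := h.monotone (proj y) v w
  have h2 := (momentum ℓ (y, v) - momentum ℓ (y, w)).le_opNorm (v - w)
  have h3 := (le_abs_self _).trans h2
  rcases (norm_nonneg (v - w)).eq_or_lt with h0 | h0
  · rw [← h0, mul_zero]; positivity
  · refine le_of_mul_le_mul_right ?_ h0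
    calc c * ‖v - w‖ * ‖v - w‖ = c * ‖v - w‖ ^ 2 := by ring
      _ ≤ _ := h1.trans h3

end IsConvexLagrangian

/-! ### The discounted problem in discrete time -/

/-- The value function of the discounted minimization problem with time step `h`, discount factor
`1 - h²` and velocities bounded by `R` exists: it is the fixed point of a contraction. -/
lemma exists_discounted_value {ℓ : Torus d → E d → ℝ}
    (hℓ : Continuous (fun z : Torus d × E d => ℓ z.1 z.2)) {h R : ℝ} (h0 : 0 < h) (h1 : h ≤ 1)
    (hR : 0 ≤ R) :
    ∃ u : C(Torus d, ℝ),
      (∀ x v, ‖v‖ ≤ R → u x ≤ (1 - h ^ 2) * u (x - proj (h • v)) + h * ℓ x v) ∧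
      ∀ x, ∃ v, ‖v‖ ≤ R ∧ u x = (1 - h ^ 2) * u (x - proj (h • v)) + h * ℓ x v := by
  let cost : C(Torus d, ℝ) → Torus d → E d → ℝ := fun u x v =>
    (1 - h ^ 2) * u (x - proj (h • v)) + h * ℓ x v
  have hcost : ∀ u, Continuous (fun z : Torus d × E d => cost u z.1 z.2) := by
    intro u
    have : Continuous (fun z : Torus d × E d => proj (h • z.2)) :=
      continuous_proj.comp (by fun_prop)
    fun_prop
  have hK : IsCompact (Metric.closedBall (0 : E d) R) := isCompact_closedBall 0 R
  have hne : (Metric.closedBall (0 : E d) R).Nonempty := ⟨0, by simpa using hR⟩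
  let T : C(Torus d, ℝ) → C(Torus d, ℝ) := fun u =>
    ⟨fun x => sInf (cost u x '' Metric.closedBall 0 R), hK.continuous_sInf (hcost u)⟩
  have hcv : ∀ u x, ContinuousOn (cost u x) (Metric.closedBall 0 R) := fun u x =>
    ((hcost u).comp (Continuous.prodMk_right x)).continuousOn
  have T_le : ∀ u x v, ‖v‖ ≤ R → T u x ≤ cost u x v := fun u x v hv =>
    csInf_le (hK.bddBelow_image (hcv u x)) ⟨v, by simpa using hv, rfl⟩
  have T_eq : ∀ u x, ∃ v, ‖v‖ ≤ R ∧ T u x = cost u x v := by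
    intro u x
    obtain ⟨v, hv, he⟩ := hK.exists_sInf_image_eq hne (hcv u x)
    exact ⟨v, by simpa using hv, he⟩
  have hδ : 0 ≤ 1 - h ^ 2 := by nlinarith
  have key : ∀ u w x, T u x - T w x ≤ (1 - h ^ 2) * dist u w := by
    intro u w x
    obtain ⟨v, hv, he⟩ := T_eq w x
    have h2 := T_le u x v hv
    have h3 : u (x - proj (h • v)) - w (x - proj (h • v)) ≤ dist u w :=
      (le_abs_self _).trans (by rw [← Real.dist_eq]; exact ContinuousMap.dist_apply_le_dist _)
    have h4 := mul_le_mul_of_nonneg_left h3 hδ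
    simp only [cost] at h2 he
    linarith
  have hT : ContractingWith (1 - h ^ 2).toNNReal T := by
    refine ⟨NNReal.coe_lt_coe.1 ?_, LipschitzWith.of_dist_le_mul fun u w => ?_⟩
    · rw [Real.coe_toNNReal _ hδ, NNReal.coe_one]
      linarith [pow_pos h0 2]
    refine (ContinuousMap.dist_le (by positivity)).2 fun x => ?_
    rw [Real.dist_eq, abs_le, Real.coe_toNNReal _ hδ]
    have a := key u w x
    have b := key w u x
    rw [dist_comm w u] at b
    constructor <;> linarith
  have : Nonempty C(Torus d, ℝ) := ⟨0⟩
  refine ⟨hT.fixedPoint T, fun x v hv => ?_, fun x => ?_⟩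
  · have := T_le (hT.fixedPoint T) x v hv
    rwa [hT.fixedPoint_isFixedPt] at this
  · obtain ⟨v, hv, he⟩ := T_eq (hT.fixedPoint T) x
    rw [hT.fixedPoint_isFixedPt] at he
    exact ⟨v, hv, he⟩

/-- An approximate solution, with time step `h`, of the ergodic problem for `ℓ`: a function `w`
and a constant `lam` such that `w x - w (x - h v) ≤ h (ℓ x v - lam)` up to an error `O(h²)`,
together with a selection `σ x` of velocities for which equality holds up to `O(h²)`, and along
which the discrete Euler-Lagrange equation is satisfied up to `O(h²)`. -/
structure IsDiscreteCorrector (ℓ : Torus d → E d → ℝ) (B R h lam : ℝ) (w : Torus d → ℝ)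
    (σ : Torus d → E d) : Prop where
  abs_lam_le : |lam| ≤ B
  abs_le : ∀ x, |w x| ≤ B
  lipschitz : ∀ x e, w x - w (x - proj e) ≤ B * (‖e‖ + h)
  dominated : ∀ x v, w x - w (x - proj (h • v)) ≤ h * (ℓ x v - lam + B * h)
  norm_le : ∀ x, ‖σ x‖ ≤ R
  calibrated : ∀ x, h * (ℓ x (σ x) - lam - B * h) ≤ w x - w (x - proj (h • σ x))
  euler : ∀ y, ‖momentum ℓ (y, σ (proj y))
      - momentum ℓ (y - h • σ (proj y), σ (proj (y - h • σ (proj y))))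
      - h • force ℓ (y - h • σ (proj y), σ (proj (y - h • σ (proj y))))‖ ≤ B * h ^ 2

section

variable {c A : ℝ} {ℓ : Torus d → E d → ℝ}

/-- The first-order condition for the intermediate point `y - h v` of two consecutive minimizing
steps: moving this point by `h w` changes the first velocity to `v - w` and the second one to
`v' + w`. -/
lemma discrete_euler_lagrange (hL : IsConvexLagrangian c A ℓ) {h : ℝ} (h0 : 0 < h) (h1 : h ≤ 1)
    {u : Torus d → ℝ}
    (hle : ∀ x v, u x ≤ (1 - h ^ 2) * u (x - proj (h • v)) + h * ℓ x v) {y v v' : E d}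
    (hv : u (proj y) = (1 - h ^ 2) * u (proj y - proj (h • v)) + h * ℓ (proj y) v)
    (hv' : u (proj (y - h • v)) = (1 - h ^ 2) * u (proj (y - h • v) - proj (h • v')) +
      h * ℓ (proj (y - h • v)) v') :
    momentum ℓ (y, v) =
      (1 - h ^ 2) • (h • force ℓ (y - h • v, v') + momentum ℓ (y - h • v, v')) := by
  set y' := y - h • v with hy'
  have hδ : 0 ≤ 1 - h ^ 2 := by nlinarith
  let g : E d → ℝ := fun w =>
    (1 - h ^ 2) * liftL ℓ (y' + h • w, v' + w) + liftL ℓ (y, v - w)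
  have hmin : IsLocalMin g 0 := by
    refine Eventually.of_forall fun w => ?_
    have e1 := hle (proj y) (v - w)
    have e2 := hle (proj (y' + h • w)) (v' + w)
    have e3 : proj y - proj (h • (v - w)) = proj (y' + h • w) := by
      rw [← proj_sub, hy', smul_sub]; congr 1; abel
    have e4 : proj (y' + h • w) - proj (h • (v' + w)) = proj y' - proj (h • v') := by
      rw [← proj_sub, ← proj_sub, smul_add]; congr 1; abel
    rw [e3] at e1
    rw [e4] at e2
    rw [← proj_sub, ← hy', hv'] at hv
    have e5 := mul_le_mul_of_nonneg_left e2 hδ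
    have : 0 ≤ h * (g w - g 0) := by
      simp only [g, liftL, smul_zero, add_zero, sub_zero]
      linarith
    have := nonneg_of_mul_nonneg_right this h0
    linarith
  have d1 : HasFDerivAt (fun w : E d => (y' + h • w, v' + w))
      ((h • ContinuousLinearMap.id ℝ (E d)).prod (ContinuousLinearMap.id ℝ (E d))) 0 :=
    (((hasFDerivAt_id (0 : E d)).const_smul h).const_add y').prodMk
      ((hasFDerivAt_id (0 : E d)).const_add v')
  have d2 : HasFDerivAt (fun w : E d => (y, v - w))
      ((0 : E d →L[ℝ] E d).prod (-ContinuousLinearMap.id ℝ (E d))) 0 :=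
    (hasFDerivAt_const y (0 : E d)).prodMk ((hasFDerivAt_id (0 : E d)).const_sub v)
  have p1 := hL.hasFDerivAt_momentum_force (y' + h • (0 : E d), v' + 0)
  have p2 := hL.hasFDerivAt_momentum_force (y, v - (0 : E d))
  have dg := ((p1.comp (0 : E d) d1).const_mul (1 - h ^ 2)).add (p2.comp (0 : E d) d2)
  have hz := hmin.hasFDerivAt_eq_zero dg
  ext a
  have := congrArg (fun f : E d →L[ℝ] ℝ => f a) hz
  simp at this ⊢
  linarith

/-- Discrete correctors exist for every time step, with bounds that do not depend on it. -/
theorem exists_discreteCorrector (hL : IsConvexLagrangian c A ℓ) :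
    ∃ B R : ℝ, 0 ≤ B ∧ ∀ h : ℝ, 0 < h → h ≤ 1 →
      ∃ lam w σ, IsDiscreteCorrector ℓ B R h lam w σ := by
  have hc := hL.pos
  obtain ⟨B₁, hB₁⟩ := hL.exists_abs_le 1
  have hB₁0 : 0 ≤ B₁ := (abs_nonneg _).trans (hB₁ 0 0 (by simp))
  -- `M` bounds `h u`, `C` is the Lipschitz constant of `u` at scales larger than `h`, and `R` is so
  -- large that velocities of norm at least `R` cost more than `u` can gain along them
  set M := B₁ + |A| with hM
  have hM0 : 0 ≤ M := by positivity
  set C := M + B₁ with hC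
  have hC0 : 0 ≤ C := by positivity
  set R := 1 + (2 * C + M + |A| + 1) / c with hR
  have hR1 : 1 ≤ R := by rw [hR]; linarith [show 0 ≤ (2 * C + M + |A| + 1) / c by positivity]
  obtain ⟨B₂, hB₂⟩ := (isPeriodicFst_momentum ℓ).bounded hL.continuous_momentum R
  obtain ⟨B₃, hB₃⟩ := (isPeriodicFst_force ℓ).bounded hL.continuous_force R
  have hB₂0 : 0 ≤ B₂ := (norm_nonneg _).trans (hB₂ 0 0 (by simp; linarith))
  have hB₃0 : 0 ≤ B₃ := (norm_nonneg _).trans (hB₃ 0 0 (by simp; linarith))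
  set B := M + C * (Real.sqrt d + 1) + B₂ + B₃ with hB
  have hCs : 0 ≤ C * Real.sqrt d := by positivity
  refine ⟨B, R, by positivity, fun h h0 h1 => ?_⟩
  obtain ⟨u, hle, hex⟩ := exists_discounted_value hL.continuous_uncurry h0 h1
    (show (0 : ℝ) ≤ R by linarith)
  have hδ : 0 ≤ 1 - h ^ 2 := by nlinarith
  have hlow : ∀ x v, -|A| ≤ ℓ x v := fun x v => by
    have := hL.lower x v
    have := le_abs_self A
    nlinarith [mul_nonneg hc.le (sq_nonneg ‖v‖)]
  have bound : ∀ x, |h * u x| ≤ M := by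
    intro x
    rw [_root_.abs_le]
    constructor
    · obtain ⟨x₀, -, hx₀'⟩ := isCompact_univ.exists_isMinOn univ_nonempty u.continuous.continuousOn
      have hx₀ : ∀ x, u x₀ ≤ u x := fun x => hx₀' (mem_univ x)
      obtain ⟨v, -, hv⟩ := hex x₀
      have a1 := mul_le_mul_of_nonneg_left (hx₀ (x₀ - proj (h • v))) hδ
      have a2 := mul_le_mul_of_nonneg_left (hlow x₀ v) h0.le
      have a3 : 0 ≤ h * (h * u x₀ + |A|) := by nlinarith
      have a4 := nonneg_of_mul_nonneg_right a3 h0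
      have a5 := mul_le_mul_of_nonneg_left (hx₀ x) h0.le
      linarith
    · have a1 := hle x 0 (by simp; linarith)
      rw [smul_zero, proj_zero, sub_zero] at a1
      have a2 := mul_le_mul_of_nonneg_left ((le_abs_self _).trans (hB₁ x 0 (by simp))) h0.le
      have a3 : 0 ≤ h * (B₁ - h * u x) := by nlinarith
      have a4 := nonneg_of_mul_nonneg_right a3 h0
      linarith [abs_nonneg A]
  -- a displacement `e` is covered by about `‖e‖ / h` steps of velocity at most one
  have step : ∀ x v, ‖v‖ ≤ 1 → u x - u (x - proj (h • v)) ≤ h * C := by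
    intro x v hv
    have a1 := hle x v (by linarith)
    have a2 := mul_le_mul_of_nonneg_left ((le_abs_self _).trans (hB₁ x v hv)) h0.le
    have a3 := mul_le_mul_of_nonneg_left
      ((neg_le_of_abs_le (bound (x - proj (h • v))))) h0.le
    nlinarith
  have lip : ∀ x e, u x - u (x - proj e) ≤ C * (‖e‖ + h) := by
    intro x e
    set n := ⌈‖e‖ / h⌉₊ with hn
    have hn1 : ‖e‖ / h ≤ n := Nat.le_ceil _
    have hn2 : (n : ℝ) < ‖e‖ / h + 1 := Nat.ceil_lt_add_one (by positivity)
    have iter : ∀ (v : E d), ‖v‖ ≤ 1 → ∀ k : ℕ,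
        u x - u (x - proj ((k : ℝ) • (h • v))) ≤ k * (h * C) := by
      intro v hv k
      induction k with
      | zero => simp [proj_zero]
      | succ k ih =>
        have s := step (x - proj ((k : ℝ) • (h • v))) v hv
        have e1 : x - proj ((k : ℝ) • (h • v)) - proj (h • v) =
            x - proj (((k + 1 : ℕ) : ℝ) • (h • v)) := by
          rw [sub_sub, ← proj_add]; push_cast; rw [add_smul, one_smul]
        rw [e1] at s
        push_cast at s ⊢
        linarith
    have hfin : (n : ℝ) * (h * C) ≤ C * (‖e‖ + h) := by
      have : (n : ℝ) * h ≤ ‖e‖ + h := by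
        have := mul_le_mul_of_nonneg_right hn2.le h0.le
        rwa [add_mul, div_mul_cancel₀ _ h0.ne', one_mul] at this
      nlinarith
    rcases Nat.eq_zero_or_pos n with hn0 | hn0
    · have : ‖e‖ = 0 := by
        have h3 : ‖e‖ / h ≤ 0 := by simpa [hn0] using hn1
        have h4 : ‖e‖ / h * h ≤ 0 := mul_nonpos_of_nonpos_of_nonneg h3 h0.le
        rw [div_mul_cancel₀ _ h0.ne'] at h4
        exact le_antisymm h4 (norm_nonneg _)
      rw [norm_eq_zero.1 this, proj_zero, sub_zero, sub_self]
      positivity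
    · have hnr : (0 : ℝ) < n := by exact_mod_cast hn0
      have := iter ((n * h)⁻¹ • e) (by
        rw [norm_smul, norm_inv, Real.norm_of_nonneg (by positivity), inv_mul_le_iff₀ (by positivity)]
        rw [div_le_iff₀ h0] at hn1
        linarith) n
      rw [smul_smul, smul_smul, mul_inv_cancel₀ (by positivity), one_smul] at this
      linarith
  have large : ∀ x v, R ≤ ‖v‖ → u x < (1 - h ^ 2) * u (x - proj (h • v)) + h * ℓ x v := by
    intro x v hv
    have a1 := lip x (h • v)
    rw [norm_smul, Real.norm_of_nonneg h0.le] at a1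
    have a2 := mul_le_mul_of_nonneg_left (le_of_abs_le (bound (x - proj (h • v)))) h0.le
    have a3 := hL.lower x v
    have a4 : (2 * C + M + |A| + 1) ≤ c * R := by
      have : c * R = c + (2 * C + M + |A| + 1) := by rw [hR]; field_simp
      linarith
    have a5 : (2 * C + M + |A| + 1) * ‖v‖ ≤ c * ‖v‖ ^ 2 := by
      have := mul_le_mul_of_nonneg_left hv hc.le
      have := mul_le_mul_of_nonneg_right (a4.trans this) (norm_nonneg v)
      nlinarith
    have a6 : C * (‖v‖ + 1) + M + 1 ≤ ℓ x v := by
      have : 0 ≤ (C + M + |A| + 1) * (‖v‖ - 1) :=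
        mul_nonneg (by positivity) (by linarith)
      nlinarith [le_abs_self A]
    nlinarith [mul_le_mul_of_nonneg_left a6 h0.le]
  -- hence the restriction to velocities of norm at most `R` is not active, and the minimizers are
  -- critical points
  have dom : ∀ x v, u x ≤ (1 - h ^ 2) * u (x - proj (h • v)) + h * ℓ x v := by
    intro x v
    rcases le_total ‖v‖ R with hv | hv
    · exact hle x v hv
    · exact (large x v hv).le
  choose σ hσ hσe using hex
  have hw : ∀ x, |u x - u 0| ≤ C * (Real.sqrt d + 1) := by
    intro x
    obtain ⟨e, he, heb⟩ := exists_small_lift x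
    have a1 := lip x e
    rw [he, sub_self] at a1
    have a2 := lip 0 (-e)
    rw [show (0 : Torus d) - proj (-e) = x by
      rw [← he, ← proj_zero, ← proj_sub]; simp, norm_neg] at a2
    have a3 : C * (‖e‖ + h) ≤ C * (Real.sqrt d + 1) := by gcongr
    rw [_root_.abs_le]
    constructor <;> linarith
  have herr : ∀ x, |h * (h * (u x - u 0))| ≤ h * (B * h) := by
    intro x
    rw [abs_mul, abs_mul, abs_of_pos h0]
    have : |u x - u 0| ≤ B := (hw x).trans (by linarith)
    nlinarith [mul_le_mul_of_nonneg_left this (mul_pos h0 h0).le]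
  -- the discount term `h² u` splits into `h * lam` with `lam = h u(0)` and an error `O(h²)`
  refine ⟨h * u 0, fun x => u x - u 0, σ, ?_, ?_, ?_, ?_, hσ, ?_, ?_⟩
  · exact (bound 0).trans (by linarith)
  · intro x; exact (hw x).trans (by linarith)
  · intro x e
    rw [sub_sub_sub_cancel_right]
    refine (lip x e).trans (mul_le_mul_of_nonneg_right (by linarith) (by positivity))
  · intro x v
    have a1 := dom x v
    have a2 := neg_le_of_abs_le (herr (x - proj (h • v)))
    nlinarith
  · intro x
    have a1 := hσe x
    have a2 := le_of_abs_le (herr (x - proj (h • σ x)))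
    nlinarith
  · intro y
    set y' := y - h • σ (proj y)
    have key := discrete_euler_lagrange hL h0 h1 dom (hσe (proj y)) (hσe (proj y'))
    rw [key]
    have e1 : (1 - h ^ 2) • (h • force ℓ (y', σ (proj y')) + momentum ℓ (y', σ (proj y'))) -
        momentum ℓ (y', σ (proj y')) - h • force ℓ (y', σ (proj y')) =
        -(h ^ 2 • (h • force ℓ (y', σ (proj y')) + momentum ℓ (y', σ (proj y')))) := by
      module
    rw [e1, norm_neg, norm_smul, Real.norm_of_nonneg (by positivity), mul_comm]
    refine mul_le_mul_of_nonneg_right ?_ (by positivity)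
    refine (norm_add_le _ _).trans ?_
    have b1 := hB₂ y' (σ (proj y')) (hσ _)
    have b2 := hB₃ y' (σ (proj y')) (hσ _)
    rw [norm_smul, Real.norm_of_nonneg h0.le]
    have b3 : h * ‖force ℓ (y', σ (proj y'))‖ ≤ 1 * B₃ := by gcongr
    linarith

end

/-! ### Limits along an ultrafilter as the time step tends to zero -/

lemma exists_tendsto_of_norm_le {F : Type*} [NormedAddCommGroup F] [ProperSpace F]
    (U : Ultrafilter ℕ) {f : ℕ → F} {B : ℝ} (hf : ∀ᶠ n in U, ‖f n‖ ≤ B) :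
    ∃ a, ‖a‖ ≤ B ∧ Tendsto f U (𝓝 a) := by
  have hK := isCompact_closedBall (0 : F) B
  obtain ⟨a, ha, hle⟩ := hK.ultrafilter_le_nhds (U.map f) (by
    rw [Ultrafilter.coe_map, le_principal_iff, mem_map]
    filter_upwards [hf] with n hn
    simpa using hn)
  exact ⟨a, by simpa using ha, hle⟩

lemma abs_natFloor_div_mul_sub_le {r h : ℝ} (h0 : 0 < h) (hr : 0 ≤ r) :
    |(⌊r / h⌋₊ : ℝ) * h - r| ≤ h := by
  have h1 := Nat.floor_le (div_nonneg hr h0.le)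
  have h2 := (Nat.lt_floor_add_one (r / h)).le
  rw [le_div_iff₀ h0] at h1
  rw [div_le_iff₀ h0] at h2
  rw [abs_le]
  constructor <;> linarith

lemma eventually_abs_floor_sub_le {l : Filter ℕ} {h τ : ℕ → ℝ} (hpos : ∀ n, 0 < h n) {s t : ℝ}
    (hs : ∀ᶠ n in l, s ≤ τ n) (ht : ∀ᶠ n in l, t ≤ τ n) :
    ∀ᶠ n in l, |((⌊(τ n - s) / h n⌋₊ : ℝ) - ⌊(τ n - t) / h n⌋₊) * h n - (t - s)| ≤ 2 * h n := by
  filter_upwards [hs, ht] with n h1 h2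
  have a1 := abs_le.1 (abs_natFloor_div_mul_sub_le (hpos n) (sub_nonneg.2 h1))
  have a2 := abs_le.1 (abs_natFloor_div_mul_sub_le (hpos n) (sub_nonneg.2 h2))
  rw [abs_le]
  constructor <;> nlinarith

lemma tendsto_floor_sub {l : Filter ℕ} {h τ : ℕ → ℝ} (hpos : ∀ n, 0 < h n)
    (hlim : Tendsto h l (𝓝 0)) {s t : ℝ}
    (hs : ∀ᶠ n in l, s ≤ τ n) (ht : ∀ᶠ n in l, t ≤ τ n) :
    Tendsto (fun n => ((⌊(τ n - s) / h n⌋₊ : ℝ) - ⌊(τ n - t) / h n⌋₊) * h n) l (𝓝 (t - s)) := by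
  rw [tendsto_iff_norm_sub_tendsto_zero]
  refine squeeze_zero' (Eventually.of_forall fun _ => norm_nonneg _)
    (eventually_abs_floor_sub_le hpos hs ht) ?_
  simpa using hlim.const_mul 2

/-- Equicontinuity, as the time step `h n` vanishes, of the sequences `g n` with respect to the time
`j * h n` that elapses in `j` steps. -/
def IsEquicontinuousFamily {F : Type*} [NormedAddCommGroup F] (l : Filter ℕ) (h : ℕ → ℝ)
    (g : ℕ → ℕ → F) : Prop :=
  ∀ ε > 0, ∃ δ > 0, ∀ᶠ n in l, ∀ i m : ℕ, m * h n ≤ δ → ‖g n i - g n (i + m)‖ ≤ ε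

/-- Sequences `a n`, run through backwards in time with time step `h n`, whose difference
quotients are asymptotic to an equicontinuous family `g n`, converge to a differentiable
function whose derivative is the limit of `g n`. The index `j` stands for the time
`τ n - j * h n`. -/
lemma IsEquicontinuousFamily.hasDerivWithinAt {F : Type*} [NormedAddCommGroup F]
    [NormedSpace ℝ F] {l : Filter ℕ} [l.NeBot] {h τ : ℕ → ℝ} (hpos : ∀ n, 0 < h n)
    (hlim : Tendsto h l (𝓝 0)) {a g : ℕ → ℕ → F} (hg : IsEquicontinuousFamily l h g)
    (ha : ∀ ε > 0, ∀ᶠ n in l, ∀ j, ‖a n j - a n (j + 1) - h n • g n j‖ ≤ ε * h n)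
    {A G : ℝ → F} {S : Set ℝ} (hS : ∀ t ∈ S, ∀ᶠ n in l, t ≤ τ n)
    (hA : ∀ t ∈ S, Tendsto (fun n => a n ⌊(τ n - t) / h n⌋₊) l (𝓝 (A t)))
    (hG : ∀ t ∈ S, Tendsto (fun n => g n ⌊(τ n - t) / h n⌋₊) l (𝓝 (G t))) {t : ℝ} (ht : t ∈ S) :
    HasDerivWithinAt A (G t) S t := by
  have key : ∀ ε > 0, ∃ δ > 0, ∀ᶠ n in l, ∀ i j : ℕ, |((j : ℝ) - i) * h n| ≤ δ →
      ‖a n i - a n j - (((j : ℝ) - i) * h n) • g n i‖ ≤ ε * |((j : ℝ) - i) * h n| := by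
    intro ε hε
    obtain ⟨δ, hδ, hgδ⟩ := hg (ε / 3) (by positivity)
    refine ⟨δ, hδ, ?_⟩
    filter_upwards [hgδ, ha (ε / 3) (by positivity)] with n hgn han
    have fwd : ∀ i m : ℕ, m * h n ≤ δ →
        ‖a n i - a n (i + m) - (m * h n) • g n i‖ ≤ (2 * (ε / 3)) * (m * h n) := by
      intro i m
      induction m with
      | zero => simp
      | succ m ih =>
        intro hm
        push_cast at hm ⊢
        have hm' : m * h n ≤ δ := by linarith [hpos n]
        have e1 : a n i - a n (i + (m + 1)) - ((m + 1) * h n) • g n i =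
            (a n i - a n (i + m) - (m * h n) • g n i) +
            (a n (i + m) - a n (i + m + 1) - h n • g n (i + m)) -
            h n • (g n i - g n (i + m)) := by
          rw [← add_assoc]; module
        rw [e1]
        have b1 := ih hm'
        have b2 := han (i + m)
        have b3 := mul_le_mul_of_nonneg_left (hgn i m hm') (hpos n).le
        refine (norm_sub_le _ _).trans ?_
        refine (add_le_add_left (norm_add_le _ _) _).trans ?_
        rw [norm_smul, Real.norm_of_nonneg (hpos n).le]
        linarith
    intro i j hij
    rcases le_total i j with hle | hle
    · obtain ⟨m, rfl⟩ := Nat.exists_eq_add_of_le hle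
      have hm0 : 0 ≤ m * h n := mul_nonneg (Nat.cast_nonneg m) (hpos n).le
      push_cast at hij ⊢
      rw [add_sub_cancel_left, abs_of_nonneg hm0] at hij ⊢
      refine (fwd i m hij).trans ?_
      nlinarith
    · obtain ⟨m, rfl⟩ := Nat.exists_eq_add_of_le hle
      have hm0 : 0 ≤ m * h n := mul_nonneg (Nat.cast_nonneg m) (hpos n).le
      push_cast at hij ⊢
      rw [show ((j : ℝ) - (j + m)) * h n = -(m * h n) by ring, abs_neg,
        abs_of_nonneg hm0] at hij ⊢
      have e1 : a n (j + m) - a n j - (-(m * h n)) • g n (j + m) =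
          -(a n j - a n (j + m) - (m * h n) • g n j) - (m * h n) • (g n j - g n (j + m)) := by
        module
      rw [e1]
      have b1 := fwd j m hij
      have b3 := mul_le_mul_of_nonneg_left (hgn j m hij) hm0
      refine (norm_sub_le _ _).trans ?_
      rw [norm_neg, norm_smul, Real.norm_of_nonneg hm0]
      linarith
  rw [hasDerivWithinAt_iff_isLittleO, Asymptotics.isLittleO_iff]
  intro ε hε
  obtain ⟨δ, hδ, hn⟩ := key ε hε
  filter_upwards [inter_mem_nhdsWithin S (Metric.ball_mem_nhds t hδ)] with s hs
  have hd : |t - s| < δ := by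
    have := hs.2
    rwa [Metric.mem_ball, dist_comm, Real.dist_eq] at this
  have lim1 := tendsto_floor_sub hpos hlim (hS s hs.1) (hS t ht)
  have lim2 : Tendsto (fun n => ‖a n ⌊(τ n - t) / h n⌋₊ - a n ⌊(τ n - s) / h n⌋₊ -
      (((⌊(τ n - s) / h n⌋₊ : ℝ) - ⌊(τ n - t) / h n⌋₊) * h n) • g n ⌊(τ n - t) / h n⌋₊‖) l
      (𝓝 ‖A t - A s - (t - s) • G t‖) :=
    (((hA t ht).sub (hA s hs.1)).sub (lim1.smul (hG t ht))).norm
  have lim3 := lim1.abs.const_mul ε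
  have hfin : ‖A t - A s - (t - s) • G t‖ ≤ ε * |t - s| := by
    refine le_of_tendsto_of_tendsto lim2 lim3 ?_
    filter_upwards [hn, lim1.abs.eventually_le_const hd] with n h1 h2
    exact h1 _ _ h2
  have e1 : A s - A t - (s - t) • G t = -(A t - A s - (t - s) • G t) := by module
  rw [e1, norm_neg, Real.norm_eq_abs, abs_sub_comm]
  exact hfin

lemma IsEquicontinuousFamily.continuousOn {F : Type*} [NormedAddCommGroup F]
    {l : Filter ℕ} [l.NeBot] {h τ : ℕ → ℝ} (hpos : ∀ n, 0 < h n)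
    (hlim : Tendsto h l (𝓝 0)) {g : ℕ → ℕ → F} (hg : IsEquicontinuousFamily l h g)
    {G : ℝ → F} {S : Set ℝ} (hS : ∀ t ∈ S, ∀ᶠ n in l, t ≤ τ n)
    (hG : ∀ t ∈ S, Tendsto (fun n => g n ⌊(τ n - t) / h n⌋₊) l (𝓝 (G t))) :
    ContinuousOn G S := by
  rw [Metric.continuousOn_iff]
  intro t ht ε hε
  obtain ⟨δ, hδ, hgn⟩ := hg (ε / 2) (by positivity)
  refine ⟨δ, hδ, fun s hs hst => ?_⟩
  rw [Real.dist_eq, abs_sub_comm] at hst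
  have lim1 := (tendsto_floor_sub hpos hlim (hS s hs) (hS t ht)).abs.eventually_le_const hst
  refine lt_of_le_of_lt ?_ (half_lt_self hε)
  rw [dist_eq_norm]
  refine le_of_tendsto ((hG s hs).sub (hG t ht)).norm ?_
  filter_upwards [hgn, lim1] with n h1 h2
  rcases le_total ⌊(τ n - s) / h n⌋₊ ⌊(τ n - t) / h n⌋₊ with hle | hle
  · obtain ⟨m, hm⟩ := Nat.exists_eq_add_of_le hle
    rw [hm] at h2 ⊢
    refine h1 _ m (le_trans (le_of_eq ?_) h2)
    push_cast
    rw [show ∀ x y z : ℝ, (x - (x + y)) * z = -(y * z) by intros; ring, abs_neg,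
      abs_of_nonneg (mul_nonneg (Nat.cast_nonneg m) (hpos n).le)]
  · obtain ⟨m, hm⟩ := Nat.exists_eq_add_of_le hle
    rw [hm] at h2 ⊢
    rw [norm_sub_rev]
    refine h1 _ m (le_trans (le_of_eq ?_) h2)
    push_cast
    rw [add_sub_cancel_left,
      abs_of_nonneg (mul_nonneg (Nat.cast_nonneg m) (hpos n).le)]

/-- A family of discrete correctors with time steps `h n → 0`, together with the limits `lam₀`
and `u` of its constants and functions along an ultrafilter. -/
structure IsDiscreteApproximation (ℓ : Torus d → E d → ℝ) (B R : ℝ) (U : Ultrafilter ℕ)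
    (h lam : ℕ → ℝ) (w : ℕ → Torus d → ℝ) (σ : ℕ → Torus d → E d) (lam₀ : ℝ)
    (u : Torus d → ℝ) : Prop where
  nonneg : 0 ≤ B
  pos : ∀ n, 0 < h n
  le_one : ∀ n, h n ≤ 1
  step_tendsto : Tendsto h U (𝓝 0)
  corrector : ∀ n, IsDiscreteCorrector ℓ B R (h n) (lam n) (w n) (σ n)
  lam_tendsto : Tendsto lam U (𝓝 lam₀)
  tendsto : ∀ x, Tendsto (fun n => w n x) U (𝓝 (u x))

lemma exists_discreteApproximation {c A : ℝ} {ℓ : Torus d → E d → ℝ}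
    (hL : IsConvexLagrangian c A ℓ) :
    ∃ B R lam w σ lam₀ u, IsDiscreteApproximation ℓ B R (hyperfilter ℕ)
      (fun n => 1 / ((n : ℝ) + 1)) lam w σ lam₀ u := by
  obtain ⟨B, R, hB, H⟩ := exists_discreteCorrector hL
  have hpos : ∀ n : ℕ, (0 : ℝ) < 1 / ((n : ℝ) + 1) := fun n => by positivity
  have hle : ∀ n : ℕ, 1 / ((n : ℝ) + 1) ≤ 1 := fun n => by
    rw [div_le_one (by positivity)]; linarith [Nat.cast_nonneg (α := ℝ) n]
  choose lam w σ hD using fun n : ℕ => H _ (hpos n) (hle n)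
  obtain ⟨lam₀, -, hlam⟩ := exists_tendsto_of_norm_le (hyperfilter ℕ) (f := lam) (B := B)
    (Eventually.of_forall fun n => (hD n).abs_lam_le)
  choose u _ hu using fun x => exists_tendsto_of_norm_le (hyperfilter ℕ) (f := fun n => w n x)
    (B := B) (Eventually.of_forall fun n => (hD n).abs_le x)
  refine ⟨B, R, lam, w, σ, lam₀, u, hB, hpos, hle, ?_, hD, hlam, hu⟩
  exact tendsto_one_div_add_atTop_nhds_zero_nat.mono_left Nat.hyperfilter_le_atTop

namespace IsDiscreteApproximation

variable {ℓ : Torus d → E d → ℝ} {B R : ℝ} {U : Ultrafilter ℕ} {h lam : ℕ → ℝ}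
  {w : ℕ → Torus d → ℝ} {σ : ℕ → Torus d → E d} {lam₀ : ℝ} {u : Torus d → ℝ} {c A : ℝ}

lemma abs_le (D : IsDiscreteApproximation ℓ B R U h lam w σ lam₀ u) (x : Torus d) : |u x| ≤ B :=
  le_of_tendsto (D.tendsto x).abs (Eventually.of_forall fun n => (D.corrector n).abs_le x)

lemma abs_sub_le (D : IsDiscreteApproximation ℓ B R U h lam w σ lam₀ u) (n : ℕ) (x y : E d) :
    |w n (proj x) - w n (proj y)| ≤ B * (‖x - y‖ + h n) := by
  have h1 := (D.corrector n).lipschitz (proj x) (x - y)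
  have h2 := (D.corrector n).lipschitz (proj y) (y - x)
  rw [← proj_sub, sub_sub_cancel] at h1 h2
  rw [norm_sub_rev] at h2
  rw [_root_.abs_le]
  constructor <;> linarith

lemma tendsto_comp (D : IsDiscreteApproximation ℓ B R U h lam w σ lam₀ u) {x : ℕ → E d} {y : E d}
    (hx : Tendsto x U (𝓝 y)) : Tendsto (fun n => w n (proj (x n))) U (𝓝 (u (proj y))) := by
  have h1 : Tendsto (fun n => w n (proj (x n)) - w n (proj y)) U (𝓝 0) := by
    refine squeeze_zero_norm (fun n => D.abs_sub_le n (x n) y) ?_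
    have := ((tendsto_iff_norm_sub_tendsto_zero.1 hx).add D.step_tendsto).const_mul B
    simpa using this
  simpa using h1.add (D.tendsto (proj y))

lemma lipschitz (D : IsDiscreteApproximation ℓ B R U h lam w σ lam₀ u) (x y : E d) :
    |u (proj x) - u (proj y)| ≤ B * ‖x - y‖ := by
  have h1 := ((D.tendsto (proj x)).sub (D.tendsto (proj y))).abs
  have h2 : Tendsto (fun n => B * (‖x - y‖ + h n)) U (𝓝 (B * (‖x - y‖ + 0))) :=
    (D.step_tendsto.const_add _).const_mul _
  rw [add_zero] at h2
  exact le_of_tendsto_of_tendsto h1 h2 (Eventually.of_forall fun n => D.abs_sub_le n x y)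

lemma continuous (D : IsDiscreteApproximation ℓ B R U h lam w σ lam₀ u) : Continuous u := by
  rw [isOpenQuotientMap_proj.isQuotientMap.continuous_iff]
  refine (LipschitzWith.of_dist_le_mul (K := ⟨B, D.nonneg⟩) fun x y => ?_).continuous
  rw [Real.dist_eq, dist_eq_norm]
  exact D.lipschitz x y

/-- The limit function is dominated by the action of short segments. -/
lemma dominated (D : IsDiscreteApproximation ℓ B R U h lam w σ lam₀ u)
    (hL : IsConvexLagrangian c A ℓ) {K ε : ℝ} (hK : 0 ≤ K) (hε : 0 < ε) :
    ∃ δ > 0, ∀ (x v : E d) (T : ℝ), ‖v‖ ≤ K → 0 ≤ T → T ≤ δ →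
      u (proj x) - u (proj (x - T • v)) ≤ T * (ℓ (proj x) v - lam₀ + ε) := by
  obtain ⟨δ, hδ, H⟩ := (isPeriodicFst_liftL ℓ).uniform hL.continuous_liftL K hε
  refine ⟨δ / (K + 1), by positivity, fun x v T hv hT0 hT => ?_⟩
  rw [le_div_iff₀ (by positivity)] at hT
  have iter : ∀ n (j : ℕ), j * h n ≤ T →
      w n (proj x) - w n (proj (x - (j * h n) • v)) ≤
        (j * h n) * (ℓ (proj x) v + ε - lam n + B * h n) := by
    intro n j
    induction j with
    | zero => simp
    | succ j ih =>
      intro hj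
      push_cast at hj ⊢
      have hj' : j * h n ≤ T := by linarith [D.pos n]
      have hj0 : 0 ≤ j * h n := mul_nonneg (Nat.cast_nonneg j) (D.pos n).le
      have b1 := ih hj'
      have b2 := (D.corrector n).dominated (proj (x - (j * h n) • v)) v
      have e1 : proj (x - (j * h n) • v) - proj (h n • v) = proj (x - ((j + 1) * h n) • v) := by
        rw [← proj_sub]; congr 1; module
      rw [e1] at b2
      have b3 := H (x - (j * h n) • v) x v v hv hv (by
        rw [sub_sub_cancel_left, norm_neg, norm_smul, Real.norm_of_nonneg hj0]
        have : (j * h n) * ‖v‖ ≤ T * (K + 1) := by gcongr; linarith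
        linarith) (by simpa using hδ.le)
      have b4 : ℓ (proj (x - (j * h n) • v)) v ≤ ℓ (proj x) v + ε := by
        have := (le_abs_self _).trans b3
        simp only [liftL] at this
        linarith
      have b5 := mul_le_mul_of_nonneg_left b4 (D.pos n).le
      linarith
  have hlim : Tendsto (fun n => (⌊T / h n⌋₊ : ℝ) * h n) U (𝓝 T) := by
    rw [tendsto_iff_norm_sub_tendsto_zero]
    exact squeeze_zero (fun _ => norm_nonneg _)
      (fun n => abs_natFloor_div_mul_sub_le (D.pos n) hT0) D.step_tendsto
  have l1 := (D.tendsto (proj x)).sub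
    (D.tendsto_comp ((tendsto_const_nhds (x := x)).sub (hlim.smul_const v)))
  have l2 := hlim.mul (((tendsto_const_nhds (x := ℓ (proj x) v + ε)).sub D.lam_tendsto).add
    (D.step_tendsto.const_mul B))
  have := le_of_tendsto_of_tendsto l1 l2 (Eventually.of_forall fun n => iter n _ (by
    have := Nat.floor_le (div_nonneg hT0 (D.pos n).le)
    rwa [le_div_iff₀ (D.pos n)] at this))
  linarith

/-- A backward chain of minimizing steps of the `n`-th discrete problem. -/
def IsChain (h : ℕ → ℝ) (σ : ℕ → Torus d → E d) (Y : ℕ → ℕ → E d) : Prop :=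
  ∀ n j, Y n (j + 1) = Y n j - h n • σ n (proj (Y n j))

lemma chain_norm_sub_le (D : IsDiscreteApproximation ℓ B R U h lam w σ lam₀ u)
    {Y : ℕ → ℕ → E d} (hY : IsChain h σ Y) (n i m : ℕ) :
    ‖Y n i - Y n (i + m)‖ ≤ R * (m * h n) := by
  induction m with
  | zero => simp
  | succ m ih =>
    have e1 : Y n i - Y n (i + (m + 1)) =
        (Y n i - Y n (i + m)) + h n • σ n (proj (Y n (i + m))) := by
      rw [← add_assoc, hY n (i + m)]; abel
    rw [e1]
    refine (norm_add_le _ _).trans ?_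
    rw [norm_smul, Real.norm_of_nonneg (D.pos n).le]
    have := mul_le_mul_of_nonneg_left ((D.corrector n).norm_le (proj (Y n (i + m)))) (D.pos n).le
    push_cast
    linarith

/-- The velocities along discrete minimizing chains are equicontinuous: the momenta are, by the
discrete Euler-Lagrange equation, and the velocity is a function of position and momentum by
strong monotonicity. -/
lemma chain_velocity_equicontinuous (D : IsDiscreteApproximation ℓ B R U h lam w σ lam₀ u)
    (hL : IsConvexLagrangian c A ℓ) {Y : ℕ → ℕ → E d} (hY : IsChain h σ Y) :
    IsEquicontinuousFamily U h (fun n j => σ n (proj (Y n j))) := by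
  obtain ⟨B₃, hB₃⟩ := (isPeriodicFst_force ℓ).bounded hL.continuous_force R
  have hc := hL.pos
  have hR : 0 ≤ R := (norm_nonneg _).trans ((D.corrector 0).norm_le 0)
  have hB₃0 : 0 ≤ B₃ := (norm_nonneg _).trans (hB₃ 0 0 (by simpa using hR))
  have hB := D.nonneg
  have mom : ∀ n i m : ℕ, ‖momentum ℓ (Y n i, σ n (proj (Y n i))) -
      momentum ℓ (Y n (i + m), σ n (proj (Y n (i + m))))‖ ≤ (B + B₃) * (m * h n) := by
    intro n i m
    induction m with
    | zero => simp
    | succ m ih =>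
      have b2 := (D.corrector n).euler (Y n (i + m))
      rw [← hY n (i + m)] at b2
      have b3 := hB₃ (Y n (i + m + 1)) _ ((D.corrector n).norm_le (proj (Y n (i + m + 1))))
      have b4 := mul_le_mul_of_nonneg_left b3 (D.pos n).le
      have b5 : B * h n ^ 2 ≤ B * h n := by
        have := D.le_one n
        have := D.pos n
        refine mul_le_mul_of_nonneg_left ?_ hB
        nlinarith
      rw [← add_assoc]
      set p := momentum ℓ (Y n i, σ n (proj (Y n i)))
      set q := momentum ℓ (Y n (i + m), σ n (proj (Y n (i + m))))
      set r := momentum ℓ (Y n (i + m + 1), σ n (proj (Y n (i + m + 1))))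
      set f := force ℓ (Y n (i + m + 1), σ n (proj (Y n (i + m + 1))))
      have e1 : p - r = (p - q) + (q - r - h n • f) + h n • f := by abel
      rw [e1]
      refine (norm_add₃_le).trans ?_
      rw [norm_smul, Real.norm_of_nonneg (D.pos n).le]
      push_cast
      linarith
  intro ε hε
  obtain ⟨δ, hδ, H⟩ := (isPeriodicFst_momentum ℓ).uniform hL.continuous_momentum R
    (show 0 < c * ε / 2 by positivity)
  refine ⟨min (δ / (R + 1)) (c * ε / 2 / (B + B₃ + 1)), by positivity,
    Eventually.of_forall fun n i m hm => ?_⟩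
  have h1 := hm.trans (min_le_left _ _)
  have h2 := hm.trans (min_le_right _ _)
  rw [le_div_iff₀ (by positivity)] at h1 h2
  have hm0 : 0 ≤ m * h n := mul_nonneg (Nat.cast_nonneg m) (D.pos n).le
  have b1 := hL.norm_sub_le_momentum (Y n i) (σ n (proj (Y n i))) (σ n (proj (Y n (i + m))))
  have b2 := mom n i m
  have b3 := H (Y n (i + m)) (Y n i) (σ n (proj (Y n (i + m)))) (σ n (proj (Y n (i + m))))
    ((D.corrector n).norm_le _) ((D.corrector n).norm_le _)
    (by rw [norm_sub_rev]; exact (D.chain_norm_sub_le hY n i m).trans (by linarith))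
    (by simpa using hδ.le)
  have b4 := norm_add_le
    (momentum ℓ (Y n i, σ n (proj (Y n i))) -
      momentum ℓ (Y n (i + m), σ n (proj (Y n (i + m)))))
    (momentum ℓ (Y n (i + m), σ n (proj (Y n (i + m)))) -
      momentum ℓ (Y n i, σ n (proj (Y n (i + m)))))
  rw [sub_add_sub_cancel] at b4
  refine le_of_mul_le_mul_left ?_ hc
  linarith

lemma chain_equicontinuous (D : IsDiscreteApproximation ℓ B R U h lam w σ lam₀ u)
    (hL : IsConvexLagrangian c A ℓ) {Y : ℕ → ℕ → E d} (hY : IsChain h σ Y)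
    {F : Type*} [NormedAddCommGroup F] {f : E d × E d → F} (hp : IsPeriodicFst f)
    (hf : Continuous f) :
    IsEquicontinuousFamily U h (fun n j => f (Y n j, σ n (proj (Y n j)))) := by
  have hR : 0 ≤ R := (norm_nonneg _).trans ((D.corrector 0).norm_le 0)
  intro ε hε
  obtain ⟨δ, hδ, H⟩ := hp.uniform hf R hε
  obtain ⟨δ', hδ', H'⟩ := D.chain_velocity_equicontinuous hL hY δ hδ
  refine ⟨min δ' (δ / (R + 1)), by positivity, ?_⟩
  filter_upwards [H'] with n hn i m hm
  have h1 := hm.trans (min_le_right _ _)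
  rw [le_div_iff₀ (by positivity)] at h1
  have hm0 : 0 ≤ m * h n := mul_nonneg (Nat.cast_nonneg m) (D.pos n).le
  exact H _ _ _ _ ((D.corrector n).norm_le _) ((D.corrector n).norm_le _)
    ((D.chain_norm_sub_le hY n i m).trans (by linarith)) (hn i m (hm.trans (min_le_left _ _)))

/-- Discrete minimizing chains, which start at time `τ n` and run backwards, converge to curves that
solve the Euler-Lagrange equation and are calibrated by `u`, on every set `S` of times that the
chains eventually cover. The bound `K` is on their positions at time zero. -/
theorem exists_calibrated_curve (D : IsDiscreteApproximation ℓ B R U h lam w σ lam₀ u)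
    (hL : IsConvexLagrangian c A ℓ) {Y : ℕ → ℕ → E d} (hY : IsChain h σ Y) {τ : ℕ → ℝ}
    {S : Set ℝ} (h0 : (0 : ℝ) ∈ S) (hS : ∀ t ∈ S, ∀ᶠ n in (U : Filter ℕ), t ≤ τ n) {K : ℝ}
    (hK : ∀ n, ‖Y n ⌊τ n / h n⌋₊‖ ≤ K) :
    ∃ X V : ℝ → E d, Tendsto (fun n => Y n ⌊τ n / h n⌋₊) U (𝓝 (X 0)) ∧ ContinuousOn V S ∧
      ∀ t ∈ S, ‖V t‖ ≤ R ∧ HasDerivWithinAt X (V t) S t ∧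
        HasDerivWithinAt (fun s => momentum ℓ (X s, V s)) (force ℓ (X t, V t)) S t ∧
        HasDerivWithinAt (fun s => u (proj (X s))) (ℓ (proj (X t)) (V t) - lam₀) S t := by
  have hR : 0 ≤ R := (norm_nonneg _).trans ((D.corrector 0).norm_le 0)
  have hB := D.nonneg
  let ι : ℝ → ℕ → ℕ := fun t n => ⌊(τ n - t) / h n⌋₊
  have exV : ∀ t, ∃ a, ‖a‖ ≤ R ∧ Tendsto (fun n => σ n (proj (Y n (ι t n)))) U (𝓝 a) := fun t =>
    exists_tendsto_of_norm_le U (Eventually.of_forall fun n => (D.corrector n).norm_le _)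
  choose V hVR hV using exV
  have ex : ∀ t, ∃ a, t ∈ S → Tendsto (fun n => Y n (ι t n)) U (𝓝 a) := by
    intro t
    by_cases ht : t ∈ S
    · obtain ⟨a, -, ha⟩ := exists_tendsto_of_norm_le U (f := fun n => Y n (ι t n))
        (B := K + R * (|t| + 2)) (by
          filter_upwards [eventually_abs_floor_sub_le D.pos (hS t ht) (hS 0 h0)] with n hn
          rw [sub_zero, zero_sub] at hn
          have hk := hK n
          have hd : ‖Y n (ι t n) - Y n ⌊τ n / h n⌋₊‖ ≤
              R * |((ι t n : ℝ) - ⌊τ n / h n⌋₊) * h n| := by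
            rcases le_total (ι t n) ⌊τ n / h n⌋₊ with hle | hle
            · obtain ⟨m, hm⟩ := Nat.exists_eq_add_of_le hle
              rw [hm]
              push_cast
              rw [show ∀ x y z : ℝ, (x - (x + y)) * z = -(y * z) by intros; ring, abs_neg,
                abs_of_nonneg (mul_nonneg (Nat.cast_nonneg m) (D.pos n).le)]
              exact D.chain_norm_sub_le hY n _ m
            · obtain ⟨m, hm⟩ := Nat.exists_eq_add_of_le hle
              rw [hm, norm_sub_rev]
              push_cast
              rw [add_sub_cancel_left,
                abs_of_nonneg (mul_nonneg (Nat.cast_nonneg m) (D.pos n).le)]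
              exact D.chain_norm_sub_le hY n _ m
          have h3 : |((ι t n : ℝ) - ⌊τ n / h n⌋₊) * h n| ≤ |t| + 2 := by
            have e1 := abs_sub_abs_le_abs_sub (((ι t n : ℝ) - ⌊τ n / h n⌋₊) * h n) (-t)
            rw [abs_neg] at e1
            linarith [D.le_one n]
          have h4 := norm_add_le (Y n (ι t n) - Y n ⌊τ n / h n⌋₊) (Y n ⌊τ n / h n⌋₊)
          rw [sub_add_cancel] at h4
          have := mul_le_mul_of_nonneg_left h3 hR
          linarith)
      exact ⟨a, fun _ => ha⟩
    · exact ⟨0, fun hh => absurd hh ht⟩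
  choose X hX using ex
  have hXV : ∀ t ∈ S, Tendsto (fun n => (Y n (ι t n), σ n (proj (Y n (ι t n))))) U
      (𝓝 (X t, V t)) := fun t ht => (hX t ht).prodMk_nhds (hV t)
  have eqV := D.chain_velocity_equicontinuous hL hY
  have eqF := D.chain_equicontinuous hL hY (isPeriodicFst_force ℓ) hL.continuous_force
  have eqL := D.chain_equicontinuous hL hY (isPeriodicFst_liftL ℓ) hL.continuous_liftL
  refine ⟨X, V, by simpa [ι] using hX 0 h0, eqV.continuousOn D.pos D.step_tendsto hS
    fun t _ => hV t, fun t ht => ⟨hVR t, ?_, ?_, ?_⟩⟩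
  · refine eqV.hasDerivWithinAt D.pos D.step_tendsto (a := Y) (fun ε hε => ?_) hS hX
      (fun t _ => hV t) ht
    refine Eventually.of_forall fun n j => ?_
    rw [hY n j, sub_sub_cancel, sub_self, norm_zero]
    exact (mul_pos hε (D.pos n)).le
  · refine eqF.hasDerivWithinAt D.pos D.step_tendsto
      (a := fun n j => momentum ℓ (Y n j, σ n (proj (Y n j)))) (fun ε hε => ?_) hS
      (fun t ht => (hL.continuous_momentum.tendsto _).comp (hXV t ht))
      (fun t ht => (hL.continuous_force.tendsto _).comp (hXV t ht)) ht
    obtain ⟨δ, hδ, H⟩ := eqF (ε / 2) (by positivity)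
    have hsm : ∀ᶠ n in (U : Filter ℕ), B * h n ≤ ε / 2 := by
      have := D.step_tendsto.const_mul B
      rw [mul_zero] at this
      exact this.eventually_le_const (by positivity)
    filter_upwards [H, D.step_tendsto.eventually_le_const hδ, hsm] with n h1 h2 h3 j
    have b1 := (D.corrector n).euler (Y n j)
    rw [← hY n j] at b1
    have b2 := mul_le_mul_of_nonneg_left (h1 j 1 (by simpa using h2)) (D.pos n).le
    set p := momentum ℓ (Y n j, σ n (proj (Y n j)))
    set r := momentum ℓ (Y n (j + 1), σ n (proj (Y n (j + 1))))
    set f := force ℓ (Y n j, σ n (proj (Y n j)))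
    set f' := force ℓ (Y n (j + 1), σ n (proj (Y n (j + 1))))
    have e1 : p - r - h n • f = (p - r - h n • f') - h n • (f - f') := by module
    rw [e1]
    refine (norm_sub_le _ _).trans ?_
    rw [norm_smul, Real.norm_of_nonneg (D.pos n).le]
    have b3 := mul_le_mul_of_nonneg_right h3 (D.pos n).le
    nlinarith
  · have eqL' : IsEquicontinuousFamily U h
        (fun n j => liftL ℓ (Y n j, σ n (proj (Y n j))) - lam₀) := by
      simpa only [IsEquicontinuousFamily, sub_sub_sub_cancel_right] using eqL
    refine eqL'.hasDerivWithinAt D.pos D.step_tendsto (a := fun n j => w n (proj (Y n j)))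
      (fun ε hε => ?_) hS (fun t ht => D.tendsto_comp (hX t ht))
      (fun t ht => ((hL.continuous_liftL.tendsto _).comp (hXV t ht)).sub_const lam₀) ht
    have hsm : ∀ᶠ n in (U : Filter ℕ), |lam n - lam₀| + B * h n ≤ ε := by
      have h1 := (tendsto_iff_norm_sub_tendsto_zero.1 D.lam_tendsto).add
        (D.step_tendsto.const_mul B)
      rw [mul_zero, add_zero] at h1
      exact h1.eventually_le_const hε
    filter_upwards [hsm] with n h1 j
    have b1 := (D.corrector n).dominated (proj (Y n j)) (σ n (proj (Y n j)))
    have b2 := (D.corrector n).calibrated (proj (Y n j))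
    rw [← proj_sub, ← hY n j] at b1 b2
    have b3 := mul_le_mul_of_nonneg_left h1 (D.pos n).le
    have b4 := mul_le_mul_of_nonneg_left (neg_abs_le (lam n - lam₀)) (D.pos n).le
    have b5 := mul_le_mul_of_nonneg_left (le_abs_self (lam n - lam₀)) (D.pos n).le
    rw [Real.norm_eq_abs, _root_.abs_le]
    simp only [liftL, smul_eq_mul]
    constructor <;> nlinarith

end IsDiscreteApproximation

/-! ### Viscosity solutions of the ergodic equation -/

lemma deriv_nonneg_of_right_min {f : ℝ → ℝ} {f' a : ℝ} (hf : HasDerivWithinAt f f' (Ioi a) a)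
    (hmin : ∀ᶠ s in 𝓝[>] a, f a ≤ f s) : 0 ≤ f' := by
  rw [hasDerivWithinAt_iff_tendsto_slope' self_notMem_Ioi] at hf
  refine ge_of_tendsto hf ?_
  filter_upwards [hmin, self_mem_nhdsWithin] with s hs hs'
  rw [slope_def_field]
  exact div_nonneg (sub_nonneg.2 hs) (sub_nonneg.2 (mem_Ioi.1 hs').le)

lemma deriv_nonpos_of_left_min {f : ℝ → ℝ} {f' a : ℝ} (hf : HasDerivWithinAt f f' (Iio a) a)
    (hmin : ∀ᶠ s in 𝓝[<] a, f a ≤ f s) : f' ≤ 0 := by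
  rw [hasDerivWithinAt_iff_tendsto_slope' self_notMem_Iio] at hf
  refine le_of_tendsto hf ?_
  filter_upwards [hmin, self_mem_nhdsWithin] with s hs hs'
  rw [slope_def_field]
  exact div_nonpos_of_nonneg_of_nonpos (sub_nonneg.2 hs) (sub_nonpos.2 (mem_Iio.1 hs').le)

lemma inner_gradient {f : E d → ℝ} (x v : E d) : inner ℝ (gradient f x) v = fderiv ℝ f x v := by
  simp [gradient]

section Hamiltonian

variable {c A : ℝ} {ℓ : Torus d → E d → ℝ}

lemma IsConvexLagrangian.bddAbove (hL : IsConvexLagrangian c A ℓ) (x : Torus d) (p : E d) :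
    BddAbove (range fun v : E d => inner ℝ p v - ℓ x v) := by
  refine ⟨‖p‖ ^ 2 / (4 * c) + A, ?_⟩
  rintro _ ⟨v, rfl⟩
  have hc := hL.pos
  have h1 := real_inner_le_norm p v
  have h2 := hL.lower x v
  have h3 : ‖p‖ * ‖v‖ ≤ ‖p‖ ^ 2 / (4 * c) + c * ‖v‖ ^ 2 := by
    have : ‖p‖ ^ 2 / (4 * c) + c * ‖v‖ ^ 2 - ‖p‖ * ‖v‖ = (‖p‖ - 2 * c * ‖v‖) ^ 2 / (4 * c) := by
      field_simp; ring
    have h4 : 0 ≤ (‖p‖ - 2 * c * ‖v‖) ^ 2 / (4 * c) := by positivity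
    linarith
  simp only
  linarith

/-- The Fenchel inequality. -/
lemma IsConvexLagrangian.inner_sub_le (hL : IsConvexLagrangian c A ℓ) (x : Torus d) (p v : E d) :
    inner ℝ p v - ℓ x v ≤ hamiltonian ℓ x p :=
  le_ciSup (hL.bddAbove x p) v

end Hamiltonian

/-- Limits of discrete correctors are viscosity solutions. The subsolution property is
infinitesimal domination along straight segments, the supersolution property is tested along a
calibrated curve ending at the given point. -/
theorem IsDiscreteApproximation.isViscositySolution {ℓ : Torus d → E d → ℝ} {B R : ℝ}
    {U : Ultrafilter ℕ} {h lam : ℕ → ℝ} {w : ℕ → Torus d → ℝ} {σ : ℕ → Torus d → E d}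
    {lam₀ : ℝ} {u : Torus d → ℝ} {c A : ℝ}
    (D : IsDiscreteApproximation ℓ B R U h lam w σ lam₀ u) (hL : IsConvexLagrangian c A ℓ) :
    IsViscositySolution (hamiltonian ℓ) (fun _ => -lam₀) u := by
  constructor
  · intro φ hφ x hmax
    refine ciSup_le fun v => ?_
    rw [inner_gradient]
    refine le_of_forall_pos_le_add fun ε hε => ?_
    obtain ⟨δ, hδ, H⟩ := D.dominated hL (norm_nonneg v) hε
    set a := ℓ (proj x) v - lam₀ + ε with ha
    have hseg : HasDerivAt (fun T : ℝ => x - T • v) (-v) 0 := by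
      simpa using ((hasDerivAt_id (0 : ℝ)).smul_const v).const_sub x
    have hd : HasDerivAt (fun T : ℝ => φ (proj (x - T • v)) + T * a)
        (fderiv ℝ (fun y => φ (proj y)) x (-v) + 1 * a) 0 := by
      have h1 : HasFDerivAt (fun y => φ (proj y)) (fderiv ℝ (fun y => φ (proj y)) x)
          (x - (0 : ℝ) • v) := by
        rw [zero_smul, sub_zero]
        exact (hφ.differentiable one_ne_zero x).hasFDerivAt
      exact (h1.comp_hasDerivAt (0 : ℝ) hseg).add ((hasDerivAt_id (0 : ℝ)).mul_const a)
    have hcont : Tendsto (fun T : ℝ => proj (x - T • v)) (𝓝 0) (𝓝 (proj x)) := by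
      have : Continuous (fun T : ℝ => proj (x - T • v)) := continuous_proj.comp (by fun_prop)
      simpa using this.tendsto 0
    have hge := deriv_nonneg_of_right_min hd.hasDerivWithinAt (by
      filter_upwards [nhdsWithin_le_nhds (hcont.eventually hmax),
        Ioc_mem_nhdsGT hδ] with T hT hT'
      have := H x v T le_rfl hT'.1.le hT'.2
      simp only [zero_smul, sub_zero, zero_mul, add_zero] at hT ⊢
      linarith)
    rw [map_neg] at hge
    linarith
  · intro ψ hψ x hmin
    let Y : ℕ → ℕ → E d := fun n j => (fun y => y - h n • σ n (proj y))^[j] x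
    have hY : IsChain h σ Y := fun n j => by
      simp only [Y, Function.iterate_succ_apply']
    obtain ⟨X, V, hX0, -, HX⟩ := D.exists_calibrated_curve hL hY (τ := fun _ => 0) (S := Iic 0)
      (K := ‖x‖) (by simp) (fun t ht => Eventually.of_forall fun _ => ht) (fun n => by simp [Y])
    have hx : X 0 = x := by
      refine tendsto_nhds_unique hX0 ?_
      simp [Y]
    obtain ⟨-, hXd, -, hud⟩ := HX 0 (by simp)
    have h1 : HasFDerivAt (fun y => ψ (proj y)) (fderiv ℝ (fun y => ψ (proj y)) x) (X 0) := by
      rw [hx]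
      exact (hψ.differentiable one_ne_zero x).hasFDerivAt
    have hd := (hud.sub (h1.comp_hasDerivWithinAt (0 : ℝ) hXd)).mono Iio_subset_Iic_self
    have hcont : Tendsto (fun s => proj (X s)) (𝓝[<] 0) (𝓝 (proj x)) := by
      have h2 : Tendsto X (𝓝[<] 0) (𝓝 (X 0)) :=
        hXd.continuousWithinAt.mono_left (nhdsWithin_mono _ Iio_subset_Iic_self)
      rw [hx] at h2
      exact (continuous_proj.tendsto x).comp h2
    have hle := deriv_nonpos_of_left_min hd (by
      filter_upwards [hcont.eventually hmin] with s hs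
      simpa [hx] using hs)
    have h3 := hL.inner_sub_le (proj x) (gradient (fun y => ψ (proj y)) x) (V 0)
    rw [inner_gradient] at h3
    rw [hx] at hle
    linarith

/-! ### Comparison of ergodic constants -/

/-- The function `∑ k, (1 - cos (2π x_k))` on the torus, which vanishes at the origin only. -/
def penalty (x : Torus d) : ℝ :=
  ∑ k : Fin d, (show Function.Periodic (fun r : ℝ => 1 - Real.cos (2 * Real.pi * r)) 1 from
    fun r => by simp only [mul_add, mul_one, Real.cos_add_two_pi]).lift (x k)

lemma penalty_proj (y : E d) :
    penalty (proj y) = ∑ k : Fin d, (1 - Real.cos (2 * Real.pi * y k)) := rfl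

lemma contDiff_penalty_proj : ContDiff ℝ 1 (fun y : E d => penalty (proj y)) := by
  simp only [penalty_proj]
  fun_prop

lemma continuous_penalty : Continuous (penalty : Torus d → ℝ) :=
  isOpenQuotientMap_proj.isQuotientMap.continuous_iff.2 contDiff_penalty_proj.continuous

lemma eq_zero_of_penalty_nonpos {x : Torus d} (hx : penalty x ≤ 0) : x = 0 := by
  obtain ⟨y, rfl⟩ := proj_surjective x
  rw [penalty_proj] at hx
  have h0 : ∀ k ∈ Finset.univ, 0 ≤ 1 - Real.cos (2 * Real.pi * y k) := fun k _ =>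
    sub_nonneg.2 (Real.cos_le_one _)
  have h1 := (Finset.sum_eq_zero_iff_of_nonneg h0).1 (le_antisymm hx (Finset.sum_nonneg h0))
  funext k
  obtain ⟨n, hn⟩ := (Real.cos_eq_one_iff _).1 (sub_eq_zero.1 (h1 k (Finset.mem_univ k))).symm
  have : y k = n := by
    have := Real.pi_pos
    have h2 : 2 * Real.pi * (y k - n) = 0 := by linarith
    rcases mul_eq_zero.1 h2 with h3 | h3
    · linarith
    · linarith
  simp [proj, this]

/-- If `z₁` is a viscosity subsolution of `H = -lam₁` and `z₂` a viscosity supersolution of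
`H = -lam₂`, then `lam₁ ≤ lam₂`. The variables are doubled with the periodic penalization; the
momenta stay bounded since `H` is coercive. -/
theorem ergodic_comparison {c A : ℝ} {ℓ : Torus d → E d → ℝ} (hL : IsConvexLagrangian c A ℓ)
    {z₁ z₂ : Torus d → ℝ} {lam₁ lam₂ : ℝ} (hc₁ : Continuous z₁) (hc₂ : Continuous z₂)
    (h₁ : IsViscositySolution (hamiltonian ℓ) (fun _ => -lam₁) z₁)
    (h₂ : IsViscositySolution (hamiltonian ℓ) (fun _ => -lam₂) z₂) : lam₁ ≤ lam₂ := by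
  have hc := hL.pos
  obtain ⟨B₁, hB₁⟩ := hL.exists_abs_le 1
  have hB₁0 : 0 ≤ B₁ := (abs_nonneg _).trans (hB₁ 0 0 (by simp))
  obtain ⟨K₁, hK₁⟩ := isCompact_univ.exists_bound_of_continuousOn hc₁.continuousOn
  obtain ⟨K₂, hK₂⟩ := isCompact_univ.exists_bound_of_continuousOn hc₂.continuousOn
  set P := B₁ + |lam₁| with hP
  set W := 1 + (P + |A| + |lam₂| + 1) / c with hW
  have hW1 : 1 ≤ W := by
    rw [hW]; linarith [show 0 ≤ (P + |A| + |lam₂| + 1) / c by positivity]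
  have step : ∀ n : ℕ, ∃ q : Torus d × Torus d × E d, ‖q.2.2‖ ≤ W ∧
      ((n : ℝ) + 1) * penalty (q.1 - q.2.1) ≤ 2 * (K₁ + K₂) ∧
      lam₁ - lam₂ ≤ ℓ q.1 q.2.2 - ℓ q.2.1 q.2.2 + 1 / ((n : ℝ) + 1) := by
    intro n
    set N : ℝ := (n : ℝ) + 1 with hN
    have hN1 : 1 ≤ N := by rw [hN]; linarith [Nat.cast_nonneg (α := ℝ) n]
    have hθ : Continuous (fun q : Torus d × Torus d => z₁ q.1 - z₂ q.2 - N * penalty (q.1 - q.2)) :=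
      ((hc₁.comp continuous_fst).sub (hc₂.comp continuous_snd)).sub
        (continuous_const.mul (continuous_penalty.comp (continuous_fst.sub continuous_snd)))
    obtain ⟨⟨x, y⟩, -, hmax⟩ := isCompact_univ.exists_isMaxOn univ_nonempty hθ.continuousOn
    have hmax' : ∀ x' y', z₁ x' - z₂ y' - N * penalty (x' - y') ≤
        z₁ x - z₂ y - N * penalty (x - y) := fun x' y' => hmax (mem_univ (x', y'))
    obtain ⟨a, rfl⟩ := proj_surjective x
    obtain ⟨b, rfl⟩ := proj_surjective y
    let Q : E d → ℝ := fun e => N * penalty (proj e)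
    have hQ : ContDiff ℝ 1 Q := contDiff_const.mul contDiff_penalty_proj
    have hQd := (hQ.differentiable one_ne_zero (a - b)).hasFDerivAt
    have t₁ : ∀ e : E d, N * penalty (proj e - proj b) = Q (e - b) := fun e => by
      simp only [Q, proj_sub]
    have t₂ : ∀ e : E d, -(N * penalty (proj a - proj e)) = -Q (a - e) := fun e => by
      simp only [Q, proj_sub]
    have f₁ : HasFDerivAt (fun e => Q (e - b)) (fderiv ℝ Q (a - b)) a := by
      have := hQd.comp a (f := fun e => e - b) ((hasFDerivAt_id a).sub_const b)
      rwa [ContinuousLinearMap.comp_id] at this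
    have f₂ : HasFDerivAt (fun e => -Q (a - e)) (fderiv ℝ Q (a - b)) b := by
      have := (hQd.comp b (f := fun e => a - e) ((hasFDerivAt_id b).const_sub a)).neg
      rwa [ContinuousLinearMap.comp_neg, neg_neg, ContinuousLinearMap.comp_id] at this
    set p := gradient (fun e => Q (e - b)) a with hp
    have hp₂ : gradient (fun e => -Q (a - e)) b = p := by
      rw [hp, gradient, gradient, f₁.fderiv, f₂.fderiv]
    have s₁ := h₁.1 (fun x => N * penalty (x - proj b)) (by
      simp only [t₁]; exact hQ.comp (contDiff_id.sub contDiff_const)) a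
      (Eventually.of_forall fun x' => by
        have := hmax' x' (proj b)
        linarith)
    have s₂ := h₂.2 (fun y => -(N * penalty (proj a - y))) (by
      simp only [t₂]; exact (hQ.comp (contDiff_const.sub contDiff_id)).neg) b
      (Eventually.of_forall fun y' => by
        have := hmax' (proj a) y'
        linarith)
    simp only [t₁] at s₁
    simp only [t₂] at s₂
    rw [hp₂] at s₂
    rw [← hp] at s₁
    -- coercivity: test the Hamiltonian with the unit velocity in the direction of `p`
    have hpb : ‖p‖ ≤ P := by
      have b1 := hL.inner_sub_le (proj a) p (‖p‖⁻¹ • p)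
      have b2 : ‖‖p‖⁻¹ • p‖ ≤ 1 := by
        rw [norm_smul, norm_inv, norm_norm]
        exact inv_mul_le_one
      have b3 := (le_abs_self _).trans (hB₁ (proj a) _ b2)
      rw [inner_smul_right, real_inner_self_eq_norm_sq] at b1
      have b4 : ‖p‖⁻¹ * ‖p‖ ^ 2 = ‖p‖ := by
        rcases eq_or_ne ‖p‖ 0 with h0 | h0
        · simp [h0]
        · field_simp
      have := neg_abs_le lam₁
      linarith
    -- a nearly optimal velocity at the second point is also a competitor at the first one, so that
    -- the gap between the constants is controlled by the variation of `ℓ` in position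
    obtain ⟨v, hv⟩ := exists_lt_of_lt_ciSup
      (show hamiltonian ℓ (proj b) p - 1 / N < ⨆ v : E d, (inner ℝ p v - ℓ (proj b) v) from
        sub_lt_self _ (by positivity))
    have hNi : 1 / N ≤ 1 := by rw [div_le_one (by linarith)]; exact hN1
    refine ⟨(proj a, proj b, v), ?_, ?_, ?_⟩
    · by_contra! hlt
      simp only at hlt
      have b1 := hL.lower (proj b) v
      have b2 := (real_inner_le_norm p v).trans (mul_le_mul_of_nonneg_right hpb (norm_nonneg v))
      have b3 : c * W = c + (P + |A| + |lam₂| + 1) := by rw [hW]; field_simp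
      have b4 : c * W * ‖v‖ ≤ c * ‖v‖ ^ 2 := by
        rw [mul_assoc, sq]
        gcongr
      have b5 : (|A| + |lam₂| + 1) * 1 ≤ (|A| + |lam₂| + 1) * ‖v‖ := by
        gcongr; linarith
      have := le_abs_self A
      have := le_abs_self lam₂
      rw [b3] at b4
      have b7 : 0 < c * ‖v‖ := mul_pos hc (by linarith)
      nlinarith
    · have b1 := hmax' 0 0
      have b2 : penalty (0 : Torus d) = 0 := by
        rw [← proj_zero, penalty_proj]; simp
      rw [sub_zero, b2, mul_zero] at b1
      have c1 := abs_le.1 (hK₁ 0 (mem_univ _))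
      have c2 := abs_le.1 (hK₂ 0 (mem_univ _))
      have c3 := abs_le.1 (hK₁ (proj a) (mem_univ _))
      have c4 := abs_le.1 (hK₂ (proj b) (mem_univ _))
      simp only
      linarith
    · have b1 := hL.inner_sub_le (proj a) p v
      simp only
      linarith
  choose q hq using step
  have hK : IsCompact ((univ : Set (Torus d)) ×ˢ (univ : Set (Torus d)) ×ˢ
      Metric.closedBall (0 : E d) W) :=
    isCompact_univ.prod (isCompact_univ.prod (isCompact_closedBall 0 W))
  obtain ⟨⟨x, y, v⟩, -, hlim⟩ := hK.ultrafilter_le_nhds ((hyperfilter ℕ).map q) (by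
    rw [Ultrafilter.coe_map, le_principal_iff, mem_map]
    exact Eventually.of_forall fun n => ⟨mem_univ _, mem_univ _, by simpa using (hq n).1⟩)
  have hlim' : Tendsto q (hyperfilter ℕ) (𝓝 (x, y, v)) := hlim
  have hinv : Tendsto (fun n : ℕ => 1 / ((n : ℝ) + 1)) (hyperfilter ℕ) (𝓝 0) :=
    tendsto_one_div_add_atTop_nhds_zero_nat.mono_left Nat.hyperfilter_le_atTop
  have hx := (continuous_fst.tendsto (x, y, v)).comp hlim'
  have hyv := (continuous_snd.tendsto (x, y, v)).comp hlim'
  have hy := (continuous_fst.tendsto (y, v)).comp hyv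
  have hv := (continuous_snd.tendsto (y, v)).comp hyv
  have hpen : penalty (x - y) ≤ 0 := by
    have l1 := (continuous_penalty.tendsto _).comp (hx.sub hy)
    have l2 := hinv.const_mul (2 * (K₁ + K₂))
    rw [mul_zero] at l2
    refine le_of_tendsto_of_tendsto l1 l2 (Eventually.of_forall fun n => ?_)
    have := (hq n).2.1
    have hn : (0 : ℝ) < (n : ℝ) + 1 := by positivity
    simp only [Function.comp_apply]
    rw [mul_one_div, le_div_iff₀ hn, mul_comm]
    exact this
  have hxy : x = y := sub_eq_zero.1 (eq_zero_of_penalty_nonpos hpen)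
  have l1 := (((hL.continuous_uncurry.tendsto _).comp (hx.prodMk_nhds hv)).sub
    ((hL.continuous_uncurry.tendsto _).comp (hy.prodMk_nhds hv))).add hinv
  have := ge_of_tendsto l1 (Eventually.of_forall fun n => (hq n).2.2)
  simp only [hxy, sub_self, add_zero] at this
  linarith

/-! ### Invariant measures and time averages -/

/-- The Krylov-Bogoliubov construction along one orbit `c` with values in a compact set: a limit
of time averages is an invariant probability measure which integrates all continuous functions
to limits of their time averages. -/
theorem exists_invariant_of_orbit {Z : Type*} [TopologicalSpace Z] [T2Space Z] [MeasurableSpace Z]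
    [BorelSpace Z] [HasOuterApproxClosed Z] {Φ : ℝ → Z → Z} (hΦ : ∀ t, Continuous (Φ t)) {c : ℝ → Z}
    (hc : Continuous c) {K : Set Z} (hK : IsCompact K) (hcK : ∀ s, c s ∈ K)
    (hΦc : ∀ t s, Φ t (c s) = c (s + t)) :
    ∃ ν : ProbabilityMeasure Z,
      (∀ t, MeasurePreserving (Φ t) (ν : Measure Z) (ν : Measure Z)) ∧
      ∀ f : Z → ℝ, Continuous f → Integrable f (ν : Measure Z) ∧
        Tendsto (fun n : ℕ => ((n : ℝ) + 1)⁻¹ * ∫ s in (0 : ℝ)..(n + 1), f (c s)) (hyperfilter ℕ)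
          (𝓝 (∫ z, f z ∂(ν : Measure Z))) := by
  have : CompactSpace K := isCompact_iff_compactSpace.1 hK
  let c' : ℝ → K := fun s => ⟨c s, hcK s⟩
  have hc' : Continuous c' := hc.subtype_mk hcK
  let m : ℕ → Measure ℝ := fun n =>
    (ENNReal.ofReal ((n : ℝ) + 1))⁻¹ • volume.restrict (Ioc (0 : ℝ) (n + 1))
  have hm : ∀ n, IsProbabilityMeasure (m n) := fun n => ⟨by
    simp only [m, Measure.smul_apply, Measure.restrict_apply_univ, Real.volume_Ioc, sub_zero,
      smul_eq_mul]
    exact ENNReal.inv_mul_cancel (by simp; positivity) ENNReal.ofReal_ne_top⟩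
  let P : ℕ → ProbabilityMeasure K := fun n =>
    ProbabilityMeasure.map (⟨m n, hm n⟩ : ProbabilityMeasure ℝ) (f := c')
      hc'.measurable.aemeasurable
  obtain ⟨ν', -, hν'⟩ := isCompact_univ.ultrafilter_le_nhds ((hyperfilter ℕ).map P) (by simp)
  have hν : Tendsto P (hyperfilter ℕ) (𝓝 ν') := hν'
  rw [ProbabilityMeasure.tendsto_iff_forall_integral_tendsto] at hν
  let ν : ProbabilityMeasure Z := ν'.map (f := Subtype.val) measurable_subtype_coe.aemeasurable
  have avg : ∀ f : Z → ℝ, Continuous f → Integrable f (ν : Measure Z) ∧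
      Tendsto (fun n : ℕ => ((n : ℝ) + 1)⁻¹ * ∫ s in (0 : ℝ)..(n + 1), f (c s)) (hyperfilter ℕ)
        (𝓝 (∫ z, f z ∂(ν : Measure Z))) := by
    intro f hf
    let g : BoundedContinuousFunction K ℝ :=
      BoundedContinuousFunction.mkOfCompact ⟨fun k => f k, hf.comp continuous_subtype_val⟩
    have hcoe : (ν : Measure Z) = Measure.map Subtype.val (ν' : Measure K) := rfl
    have hfm : AEStronglyMeasurable f (Measure.map Subtype.val (ν' : Measure K)) :=
      hf.measurable.aestronglyMeasurable
    constructor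
    · rw [hcoe, integrable_map_measure hfm measurable_subtype_coe.aemeasurable]
      exact g.integrable _
    · rw [hcoe, integral_map measurable_subtype_coe.aemeasurable hfm]
      refine (hν g).congr fun n => ?_
      have e1 : ((P n : ProbabilityMeasure K) : Measure K) = Measure.map c' (m n) := rfl
      have hn : (0 : ℝ) < (n : ℝ) + 1 := by positivity
      rw [e1, integral_map hc'.measurable.aemeasurable g.continuous.measurable.aestronglyMeasurable]
      simp only [m]
      rw [integral_smul_measure, ENNReal.toReal_inv, ENNReal.toReal_ofReal hn.le,
        intervalIntegral.integral_of_le hn.le]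
      rfl
  refine ⟨ν, fun t => ⟨(hΦ t).measurable, ?_⟩, avg⟩
  have : IsFiniteMeasure (Measure.map (Φ t) (ν : Measure Z)) :=
    Measure.isFiniteMeasure_map _ _
  refine ext_of_forall_integral_eq_of_IsFiniteMeasure fun f => ?_
  rw [integral_map (hΦ t).measurable.aemeasurable f.continuous.measurable.aestronglyMeasurable]
  have l1 := (avg (fun z => f (Φ t z)) (f.continuous.comp (hΦ t))).2
  have l2 := (avg f f.continuous).2
  have hinv : Tendsto (fun n : ℕ => 1 / ((n : ℝ) + 1)) (hyperfilter ℕ) (𝓝 0) :=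
    tendsto_one_div_add_atTop_nhds_zero_nat.mono_left Nat.hyperfilter_le_atTop
  have hcont : Continuous fun s => f (c s) := f.continuous.comp hc
  have hint : ∀ a b : ℝ, IntervalIntegrable (fun s => f (c s)) volume a b := fun a b =>
    hcont.intervalIntegrable a b
  have hdiff : Tendsto (fun n : ℕ => ((n : ℝ) + 1)⁻¹ * (∫ s in (0 : ℝ)..(n + 1), f (Φ t (c s))) -
      ((n : ℝ) + 1)⁻¹ * ∫ s in (0 : ℝ)..(n + 1), f (c s)) (hyperfilter ℕ) (𝓝 0) := by
    refine squeeze_zero_norm (a := fun n : ℕ => 1 / ((n : ℝ) + 1) * (2 * (‖f‖ * |t|)))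
      (fun n => ?_) (by simpa using hinv.mul_const (2 * (‖f‖ * |t|)))
    have hn : (0 : ℝ) < (n : ℝ) + 1 := by positivity
    have e1 : ∫ s in (0 : ℝ)..(n + 1), f (Φ t (c s)) = ∫ s in (0 + t)..(n + 1 + t), f (c s) := by
      simp only [hΦc]
      exact intervalIntegral.integral_comp_add_right (fun s => f (c s)) t
    -- shifting the window of integration by `t` changes the integral at its two ends only
    have e2 : (∫ s in (0 + t)..(n + 1 + t), f (c s)) - ∫ s in (0 : ℝ)..(n + 1), f (c s) =
        (∫ s in ((n : ℝ) + 1)..(n + 1 + t), f (c s)) - ∫ s in (0 : ℝ)..t, f (c s) := by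
      have h1 := intervalIntegral.integral_add_adjacent_intervals (hint 0 (n + 1))
        (hint (n + 1) (n + 1 + t))
      have h2 := intervalIntegral.integral_add_adjacent_intervals (hint 0 t)
        (hint t (n + 1 + t))
      rw [zero_add]
      linarith
    have b1 : ‖∫ s in ((n : ℝ) + 1)..(n + 1 + t), f (c s)‖ ≤ ‖f‖ * |(n : ℝ) + 1 + t - (n + 1)| :=
      intervalIntegral.norm_integral_le_of_norm_le_const fun s _ => f.norm_coe_le_norm _
    have b2 : ‖∫ s in (0 : ℝ)..t, f (c s)‖ ≤ ‖f‖ * |t - 0| :=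
      intervalIntegral.norm_integral_le_of_norm_le_const fun s _ => f.norm_coe_le_norm _
    rw [add_sub_cancel_left] at b1
    rw [sub_zero] at b2
    rw [← mul_sub, e1, e2, norm_mul, norm_inv, Real.norm_of_nonneg hn.le, one_div]
    refine mul_le_mul_of_nonneg_left ?_ (by positivity)
    exact (norm_sub_le _ _).trans (by linarith)
  have := l1.sub l2
  exact sub_eq_zero.1 (tendsto_nhds_unique this hdiff)

/-- If the increase of a function `g` along orbits of length one is at most the time integral of
`f - lam`, then every invariant probability measure integrates `f` to at least `lam`. -/
lemma le_integral_of_invariant {Z : Type*} [MeasurableSpace Z] {Φ : ℝ → Z → Z}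
    (hΦ : Measurable (fun p : ℝ × Z => Φ p.1 p.2)) {ν : Measure Z} [IsProbabilityMeasure ν]
    (hinv : ∀ t, MeasurePreserving (Φ t) ν ν) {f g : Z → ℝ} (hf : Integrable f ν)
    (hg : Integrable g ν) {lam : ℝ}
    (hdom : ∀ z, g (Φ 1 z) - g z ≤ (∫ t in (0 : ℝ)..1, f (Φ t z)) - lam) :
    lam ≤ ∫ z, f z ∂ν := by
  let m : Measure ℝ := volume.restrict (Ioc (0 : ℝ) 1)
  have : IsProbabilityMeasure m := ⟨by simp [m]⟩
  have hskew : MeasurePreserving (fun p : ℝ × Z => (p.1, Φ p.1 p.2)) (m.prod ν) (m.prod ν) :=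
    (MeasurePreserving.id m).skew_product hΦ (Eventually.of_forall fun t => (hinv t).map_eq)
  have hint : Integrable (fun p : ℝ × Z => f (Φ p.1 p.2)) (m.prod ν) :=
    (hskew.integrable_comp (hf.comp_snd m).aestronglyMeasurable).2 (hf.comp_snd m)
  have hswap : ∫ z, ∫ t, f (Φ t z) ∂m ∂ν = ∫ z, f z ∂ν := by
    rw [← integral_integral_swap (f := fun t z => f (Φ t z)) hint]
    have : ∀ t, ∫ z, f (Φ t z) ∂ν = ∫ z, f z ∂ν := fun t => by
      have h1 := integral_map (hinv t).measurable.aemeasurable (f := f)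
        (by rw [(hinv t).map_eq]; exact hf.aestronglyMeasurable)
      rw [(hinv t).map_eq] at h1
      exact h1.symm
    simp [this]
  have hg1 : Integrable (fun z => g (Φ 1 z)) ν :=
    ((hinv 1).integrable_comp hg.aestronglyMeasurable).2 hg
  have hg2 : ∫ z, g (Φ 1 z) ∂ν = ∫ z, g z ∂ν := by
    have h1 := integral_map (hinv 1).measurable.aemeasurable (f := g)
      (by rw [(hinv 1).map_eq]; exact hg.aestronglyMeasurable)
    rw [(hinv 1).map_eq] at h1
    exact h1.symm
  have hr : Integrable (fun z => ∫ t, f (Φ t z) ∂m) ν := hint.integral_prod_right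
  have hmono := integral_mono (hg1.sub hg) (hr.sub (integrable_const lam)) (fun z => by
    have := hdom z
    rwa [intervalIntegral.integral_of_le zero_le_one] at this)
  simp only [Pi.sub_apply] at hmono
  rw [integral_sub hg1 hg, hg2, sub_self, integral_sub hr (integrable_const lam), hswap] at hmono
  simp at hmono
  linarith

lemma extIntegral_of_integrable {α : Type*} [MeasurableSpace α] {f : α → ℝ} {η : Measure α}
    (hf : Integrable f η) : extIntegral f η = ((∫ a, f a ∂η : ℝ) : EReal) := by
  have h1 : ∫⁻ a, ENNReal.ofReal (f a) ∂η ≠ ⊤ := hf.lintegral_lt_top.ne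
  have h2 : ∫⁻ a, ENNReal.ofReal (-f a) ∂η ≠ ⊤ := hf.neg.lintegral_lt_top.ne
  rw [extIntegral, integral_eq_lintegral_pos_part_sub_lintegral_neg_part hf, EReal.coe_sub,
    EReal.coe_ennreal_toReal h1, EReal.coe_ennreal_toReal h2]

lemma extIntegral_eq_top {α : Type*} [MeasurableSpace α] {f : α → ℝ} {η : Measure α}
    [IsProbabilityMeasure η] (hfm : Measurable f) {C : ℝ} (hC : ∀ a, -C ≤ f a)
    (hf : ¬ Integrable f η) : extIntegral f η = ⊤ := by
  have h2 : ∫⁻ a, ENNReal.ofReal (-f a) ∂η ≠ ⊤ := by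
    refine ne_top_of_le_ne_top (b := ENNReal.ofReal C) ENNReal.ofReal_ne_top ?_
    calc ∫⁻ a, ENNReal.ofReal (-f a) ∂η ≤ ∫⁻ _a, ENNReal.ofReal C ∂η :=
          lintegral_mono fun a => ENNReal.ofReal_le_ofReal (by linarith [hC a])
      _ = ENNReal.ofReal C := by simp
  have h1 : ∫⁻ a, ENNReal.ofReal (f a) ∂η = ⊤ := by
    by_contra h1
    refine hf ⟨hfm.aestronglyMeasurable, ?_⟩
    have e1 : ∀ a, ‖f a‖ₑ = ENNReal.ofReal (f a) + ENNReal.ofReal (-f a) := fun a => by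
      rcases le_total 0 (f a) with h0 | h0
      · rw [Real.enorm_eq_ofReal h0, ENNReal.ofReal_of_nonpos (by linarith : -f a ≤ 0), add_zero]
      · rw [← enorm_neg, Real.enorm_eq_ofReal (by linarith), ENNReal.ofReal_of_nonpos h0, zero_add]
    rw [hasFiniteIntegral_iff_enorm]
    simp only [e1]
    rw [lintegral_add_left hfm.ennreal_ofReal]
    exact ENNReal.add_lt_top.2 ⟨lt_top_iff_ne_top.2 h1, lt_top_iff_ne_top.2 h2⟩
  rw [extIntegral, h1, EReal.coe_ennreal_top]
  lift (∫⁻ a, ENNReal.ofReal (-f a) ∂η) to NNReal using h2 with r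
  exact EReal.top_sub_coe r

/-! ### The minimal average action -/

section

variable {c A : ℝ} {ℓ : Torus d → E d → ℝ} {B R : ℝ} {U : Ultrafilter ℕ} {h lam : ℕ → ℝ}
  {w : ℕ → Torus d → ℝ} {σ : ℕ → Torus d → E d} {lam₀ : ℝ} {u : Torus d → ℝ}

/-- Domination along curves of class `C¹`. -/
lemma IsDiscreteApproximation.sub_le_action (D : IsDiscreteApproximation ℓ B R U h lam w σ lam₀ u)
    (hL : IsConvexLagrangian c A ℓ) {γ : ℝ → E d} (hγ : ContDiff ℝ 1 γ) :
    u (proj (γ 1)) - u (proj (γ 0)) ≤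
      (∫ t in (0 : ℝ)..1, ℓ (proj (γ t)) (deriv γ t)) - lam₀ := by
  have hdγ : Continuous (deriv γ) := hγ.continuous_deriv le_rfl
  let g : ℝ → ℝ := fun t => ℓ (proj (γ t)) (deriv γ t) - lam₀
  have hg : Continuous g :=
    (hL.continuous_liftL.comp (hγ.continuous.prodMk hdγ)).sub continuous_const
  have hprim : ∀ x, HasDerivAt (fun t => u (proj (γ 0)) + ∫ s in (0 : ℝ)..t, g s) (g x) x :=
    fun x => (intervalIntegral.integral_hasDerivAt_right (hg.intervalIntegrable 0 x)
      (hg.stronglyMeasurableAtFilter _ _) hg.continuousAt).const_add _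
  have key := image_le_of_liminf_slope_right_le_deriv_boundary (f := fun t => u (proj (γ t)))
    (a := 0) (b := 1) ((D.continuous.comp (continuous_proj.comp hγ.continuous)).continuousOn)
    (B := fun t => u (proj (γ 0)) + ∫ s in (0 : ℝ)..t, g s) (B' := g) (by simp)
    (fun x _ => (hprim x).continuousAt.continuousWithinAt)
    (fun x _ => (hprim x).hasDerivWithinAt) (fun x _ r hr => by
      -- `γ z` is reached from `γ x` along a segment of velocity close to `deriv γ x`
      set ε := (r - g x) / 2 with hε
      have hε0 : 0 < ε := by rw [hε]; linarith
      obtain ⟨δ, hδ, H⟩ := D.dominated hL (K := ‖deriv γ x‖ + 1) (by positivity) hε0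
      have hs : Tendsto (slope γ x) (𝓝[>] x) (𝓝 (deriv γ x)) :=
        ((hasDerivWithinAt_iff_tendsto_slope' self_notMem_Ioi).1
          (hγ.differentiable one_ne_zero x).hasDerivAt.hasDerivWithinAt)
      have hz : Tendsto γ (𝓝[>] x) (𝓝 (γ x)) :=
        hγ.continuous.continuousAt.mono_left nhdsWithin_le_nhds
      have hl : Tendsto (fun z => liftL ℓ (γ z, slope γ x z)) (𝓝[>] x)
          (𝓝 (liftL ℓ (γ x, deriv γ x))) :=
        (hL.continuous_liftL.tendsto _).comp (hz.prodMk_nhds hs)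
      refine Eventually.frequently ?_
      filter_upwards [hs.norm.eventually_le_const (lt_add_one _),
        hl.eventually_lt_const (show liftL ℓ (γ x, deriv γ x) < _ + ε from lt_add_of_pos_right _ hε0),
        Ioc_mem_nhdsGT (show x < x + δ by linarith)] with z h1 h2 h3
      have hT : 0 < z - x := sub_pos.2 h3.1
      have h4 := H (γ z) (slope γ x z) (z - x) h1 hT.le (by linarith [h3.2])
      have e1 : γ z - (z - x) • slope γ x z = γ x := by
        rw [sub_smul_slope, vsub_eq_sub, sub_sub_cancel]
      rw [e1] at h4
      rw [slope_def_field, div_lt_iff₀ hT]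
      refine lt_of_le_of_lt h4 ?_
      rw [mul_comm]
      refine mul_lt_mul_of_pos_right ?_ hT
      simp only [liftL] at h2
      have : g x = ℓ (proj (γ x)) (deriv γ x) - lam₀ := rfl
      linarith)
  have h1 := key (show (1 : ℝ) ∈ Icc 0 1 by simp)
  have h2 : ∫ s in (0 : ℝ)..1, g s =
      (∫ t in (0 : ℝ)..1, ℓ (proj (γ t)) (deriv γ t)) - lam₀ := by
    have hcont : Continuous fun t => ℓ (proj (γ t)) (deriv γ t) :=
      hL.continuous_liftL.comp (hγ.continuous.prodMk hdγ)
    simp only [g]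
    rw [intervalIntegral.integral_sub (hcont.intervalIntegrable 0 1) intervalIntegrable_const]
    simp
  simp only [h2] at h1
  linarith

/-- The action of every invariant measure is at least the ergodic constant. -/
theorem IsDiscreteApproximation.le_extIntegral
    (D : IsDiscreteApproximation ℓ B R U h lam w σ lam₀ u) (hL : IsConvexLagrangian c A ℓ)
    {ν : ProbabilityMeasure (Phase d)} (hν : IsEulerInvariant ℓ ν) :
    (lam₀ : EReal) ≤ extIntegral (fun z : Phase d => ℓ z.1 z.2) (ν : Measure (Phase d)) := by
  obtain ⟨Φ, hΦ, hinv⟩ := hν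
  by_cases hint : Integrable (fun z : Phase d => ℓ z.1 z.2) (ν : Measure (Phase d))
  · rw [extIntegral_of_integrable hint, EReal.coe_le_coe_iff]
    have hu : Continuous fun z : Phase d => u z.1 := D.continuous.comp continuous_fst
    have hui : Integrable (fun z : Phase d => u z.1) (ν : Measure (Phase d)) :=
      Integrable.of_bound hu.measurable.aestronglyMeasurable B
        (Eventually.of_forall fun z => D.abs_le z.1)
    refine le_integral_of_invariant hΦ.continuous.measurable hinv hint hui fun z => ?_
    obtain ⟨x, v⟩ := z
    obtain ⟨x₀, rfl⟩ := proj_surjective x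
    obtain ⟨γ, hγ, h0, h1⟩ := hΦ.exists_extremal x₀ v
    have hflow := hΦ.eq_extremal γ hγ
    rw [h0, h1] at hflow
    simp only [hflow]
    rw [← h0]
    exact D.sub_le_action hL hγ.1
  · rw [extIntegral_eq_top hL.continuous_uncurry.measurable (C := A) (fun z => ?_) hint]
    · exact le_top
    · have := hL.lower z.1 z.2
      have := hL.pos
      nlinarith [mul_nonneg hL.pos.le (sq_nonneg ‖z.2‖)]

/-- Calibrated curves defined for all times exist. -/
lemma IsDiscreteApproximation.exists_extremal_calibrated
    (D : IsDiscreteApproximation ℓ B R (hyperfilter ℕ) h lam w σ lam₀ u)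
    (hL : IsConvexLagrangian c A ℓ) :
    ∃ γ : ℝ → E d, IsExtremal ℓ γ ∧ (∀ t, ‖deriv γ t‖ ≤ R) ∧
      ∀ t, HasDerivAt (fun s => u (proj (γ s))) (ℓ (proj (γ t)) (deriv γ t) - lam₀) t := by
  let Y₀ : ℕ → ℕ → E d := fun n j => (fun y => y - h n • σ n (proj y))^[j] 0
  -- a lattice translation of the chain keeps its position at time zero bounded
  choose e he heb using fun n : ℕ => exists_lattice_translate (Y₀ n ⌊(n : ℝ) / h n⌋₊)
  let Y : ℕ → ℕ → E d := fun n j => Y₀ n j - e n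
  have hY : IsChain h σ Y := fun n j => by
    simp only [Y, Y₀, Function.iterate_succ_apply', proj_sub, he, sub_zero]
    abel
  obtain ⟨X, V, -, hV, HX⟩ := D.exists_calibrated_curve hL hY (τ := fun n => (n : ℝ)) (S := univ)
    (mem_univ 0)
    (fun t _ => Nat.hyperfilter_le_atTop (tendsto_natCast_atTop_atTop.eventually_ge_atTop t))
    (K := Real.sqrt d) heb
  have hX : ∀ t, HasDerivAt X (V t) t := fun t => by simpa using (HX t (mem_univ t)).2.1
  have hd : deriv X = V := funext fun t => (hX t).deriv
  refine ⟨X, ⟨?_, fun t => ?_⟩, fun t => ?_, fun t => ?_⟩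
  · rw [contDiff_one_iff_deriv, hd]
    exact ⟨fun t => (hX t).differentiableAt, continuousOn_univ.1 hV⟩
  · rw [hd]
    have := (HX t (mem_univ t)).2.2.1
    rw [hasDerivWithinAt_univ] at this
    exact this
  · rw [hd]; exact (HX t (mem_univ t)).1
  · rw [hd]; simpa using (HX t (mem_univ t)).2.2.2

lemma IsExtremal.comp_add_const {γ : ℝ → E d} (hγ : IsExtremal ℓ γ) (s : ℝ) :
    IsExtremal ℓ (fun t => γ (t + s)) := by
  have hd : ∀ t, deriv (fun t => γ (t + s)) t = deriv γ (t + s) := fun t =>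
    deriv_comp_add_const γ s t
  refine ⟨hγ.1.comp (contDiff_id.add contDiff_const), fun t => ?_⟩
  simp only [hd]
  exact (hγ.2 (t + s)).comp_add_const t s

/-- An invariant measure whose action is the ergodic constant. -/
theorem IsDiscreteApproximation.exists_minimizing_measure
    (D : IsDiscreteApproximation ℓ B R (hyperfilter ℕ) h lam w σ lam₀ u)
    (hL : IsConvexLagrangian c A ℓ) {Φ : ℝ → Phase d → Phase d} (hΦ : IsEulerFlow ℓ Φ) :
    ∃ ν : ProbabilityMeasure (Phase d), IsEulerInvariant ℓ ν ∧
      extIntegral (fun z : Phase d => ℓ z.1 z.2) (ν : Measure (Phase d)) = lam₀ := by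
  obtain ⟨γ, hγ, hR, hcal⟩ := D.exists_extremal_calibrated hL
  have hdγ : Continuous (deriv γ) := hγ.1.continuous_deriv le_rfl
  have hK : IsCompact ((univ : Set (Torus d)) ×ˢ Metric.closedBall (0 : E d) R) :=
    isCompact_univ.prod (isCompact_closedBall 0 R)
  have hflow : ∀ t s, Φ t (proj (γ s), deriv γ s) = (proj (γ (s + t)), deriv γ (s + t)) := by
    intro t s
    have h1 := hΦ.eq_extremal _ (hγ.comp_add_const s) t
    simp only [deriv_comp_add_const, zero_add, add_comm t s] at h1
    exact h1
  obtain ⟨ν, hinv, havg⟩ := exists_invariant_of_orbit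
    (fun t => hΦ.continuous.comp (Continuous.prodMk_right t))
    ((continuous_proj.comp hγ.1.continuous).prodMk hdγ) hK
    (fun s => ⟨mem_univ _, by simpa using hR s⟩) hflow
  refine ⟨ν, ⟨Φ, hΦ, hinv⟩, ?_⟩
  obtain ⟨hint, hlim⟩ := havg _ hL.continuous_uncurry
  rw [extIntegral_of_integrable hint, EReal.coe_eq_coe_iff]
  have hcont : Continuous fun t => ℓ (proj (γ t)) (deriv γ t) :=
    hL.continuous_liftL.comp (hγ.1.continuous.prodMk hdγ)
  have hinv' : Tendsto (fun n : ℕ => 1 / ((n : ℝ) + 1)) (hyperfilter ℕ) (𝓝 0) :=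
    tendsto_one_div_add_atTop_nhds_zero_nat.mono_left Nat.hyperfilter_le_atTop
  have hzero : Tendsto (fun n : ℕ => ((n : ℝ) + 1)⁻¹ *
      (u (proj (γ (n + 1))) - u (proj (γ 0)))) (hyperfilter ℕ) (𝓝 0) := by
    refine squeeze_zero_norm (a := fun n : ℕ => 1 / ((n : ℝ) + 1) * (2 * B)) (fun n => ?_)
      (by simpa using hinv'.mul_const (2 * B))
    rw [norm_mul, norm_inv, Real.norm_of_nonneg (by positivity), one_div]
    refine mul_le_mul_of_nonneg_left ?_ (by positivity)
    have := norm_sub_le (u (proj (γ (n + 1)))) (u (proj (γ 0)))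
    have b1 := D.abs_le (proj (γ (n + 1)))
    have b2 := D.abs_le (proj (γ 0))
    simp only [Real.norm_eq_abs] at this ⊢
    linarith
  have hlim2 := hzero.add_const lam₀
  rw [zero_add] at hlim2
  refine tendsto_nhds_unique hlim (hlim2.congr fun n => ?_)
  have hn : ((n : ℝ) + 1) ≠ 0 := by positivity
  have h1 := intervalIntegral.integral_eq_sub_of_hasDerivAt (a := 0) (b := (n : ℝ) + 1)
    (fun t _ => hcal t) ((hcont.sub continuous_const).intervalIntegrable _ _)
  rw [intervalIntegral.integral_sub (hcont.intervalIntegrable _ _) intervalIntegrable_const,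
    intervalIntegral.integral_const, sub_zero, smul_eq_mul] at h1
  rw [← h1]
  simp only [Function.comp_apply]
  field_simp
  ring

end

/-! ### The Lagrangian of a player -/

section

variable {N d : ℕ} {L : Fin N → Torus d → E d → ℝ} {F : Fin N → (Fin N → Torus d) → ℝ}
  {m : Fin N → ProbabilityMeasure (Torus d)} {i : Fin N}

/-- Uniform convexity of `L` makes the velocity derivative strongly monotone. -/
lemma LagrangianAssumptions.monotone (hL : LagrangianAssumptions L) {C₀ : ℝ}
    (hC : ∀ (x : Torus d) (v w : E d),
      1 / C₀ * ‖w‖ ^ 2 ≤ fderiv ℝ (fderiv ℝ (L i x)) v w w) (x : Torus d) (v w : E d) :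
    1 / C₀ * ‖v - w‖ ^ 2 ≤ (fderiv ℝ (L i x) v - fderiv ℝ (L i x) w) (v - w) := by
  obtain ⟨y, rfl⟩ := proj_surjective x
  have h2 : ContDiff ℝ 2 (L i (proj y)) :=
    (hL.contDiff i).comp (contDiff_const.prodMk contDiff_id)
  have h1 : ContDiff ℝ 1 (fderiv ℝ (L i (proj y))) := h2.fderiv_right (by norm_num)
  have hseg : ∀ s : ℝ, HasDerivAt (fun s : ℝ => w + s • (v - w)) (v - w) s := fun s => by
    simpa using ((hasDerivAt_id s).smul_const (v - w)).const_add w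
  have hd : ∀ s : ℝ, HasDerivAt (fun s : ℝ => fderiv ℝ (L i (proj y)) (w + s • (v - w)) (v - w))
      (fderiv ℝ (fderiv ℝ (L i (proj y))) (w + s • (v - w)) (v - w) (v - w)) s := fun s => by
    have h3 := ((h1.differentiable one_ne_zero (w + s • (v - w))).hasFDerivAt).comp_hasDerivAt s
      (hseg s)
    simpa using h3.clm_apply (hasDerivAt_const s (v - w))
  obtain ⟨s, -, hs⟩ := exists_hasDerivAt_eq_slope _ _ zero_lt_one
    (fun s _ => (hd s).continuousAt.continuousWithinAt) (fun s _ => hd s)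
  have h4 := hC (proj y) (w + s • (v - w)) (v - w)
  rw [hs] at h4
  simpa using h4

lemma isConvexLagrangian_playerLagrangian (hL : LagrangianAssumptions L)
    (hF : ContDiff ℝ 1 (fun q : E d × E d => playerLagrangian L F m i (proj q.1) q.2)) :
    ∃ c A, IsConvexLagrangian c A (playerLagrangian L F m i) := by
  obtain ⟨C₀, hC₀, hb⟩ := hL.bounds
  have hc : 0 < 1 / C₀ := by positivity
  -- the averaged coupling is continuous, being the difference of two Lagrangians
  have hV : Continuous (meanCoupling F i m) := by
    rw [isOpenQuotientMap_proj.isQuotientMap.continuous_iff]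
    have h1 : Continuous fun y : E d => playerLagrangian L F m i (proj y) 0 :=
      hF.continuous.comp (Continuous.prodMk_left (0 : E d))
    have h2 : Continuous fun y : E d => L i (proj y) 0 :=
      (hL.contDiff i).continuous.comp (Continuous.prodMk_left (0 : E d))
    exact (h1.sub h2).congr fun y => by simp [playerLagrangian]
  obtain ⟨M, hM⟩ := isCompact_univ.exists_bound_of_continuousOn hV.continuousOn
  refine ⟨1 / C₀, M, hc, hF, fun x v => ?_, fun x v w => ?_⟩
  · have h1 := (hb i x v).2.1
    have h2 := neg_le_of_abs_le (hM x (mem_univ x))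
    rw [playerLagrangian]
    linarith
  · have e1 : ∀ v, fderiv ℝ (playerLagrangian L F m i x) v = fderiv ℝ (L i x) v := fun v =>
      fderiv_add_const (meanCoupling F i m x)
    rw [e1, e1]
    exact hL.monotone (fun x v => (hb i x v).1) x v w

lemma hamiltonian_playerLagrangian (hL : LagrangianAssumptions L) (x : Torus d) (p : E d) :
    hamiltonian (playerLagrangian L F m i) x p =
      hamiltonian (L i) x p - meanCoupling F i m x := by
  obtain ⟨C₀, hC₀, hb⟩ := hL.bounds
  have hbdd : BddAbove (range fun v : E d => inner ℝ p v - L i x v) := by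
    refine ⟨C₀ * ‖p‖ ^ 2, ?_⟩
    rintro _ ⟨v, rfl⟩
    have h1 := (hb i x v).2.1
    have h2 := real_inner_le_norm p v
    have h3 : ‖p‖ * ‖v‖ ≤ C₀ * ‖p‖ ^ 2 + 1 / C₀ * ‖v‖ ^ 2 := by
      have e1 : C₀ * ‖p‖ ^ 2 + 1 / C₀ * ‖v‖ ^ 2 - 2 * (‖p‖ * ‖v‖) =
          (C₀ * ‖p‖ - ‖v‖) ^ 2 / C₀ := by
        field_simp; ring
      have h4 : 0 ≤ (C₀ * ‖p‖ - ‖v‖) ^ 2 / C₀ := by positivity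
      have h5 : 0 ≤ ‖p‖ * ‖v‖ := by positivity
      linarith
    have h6 : 0 ≤ 1 / C₀ := by positivity
    simp only
    linarith
  rw [hamiltonian, hamiltonian, ciSup_sub hbdd]
  exact iSup_congr fun v => by rw [playerLagrangian]; ring

/-- The ergodic equation of a player in terms of the Hamiltonian of the full Lagrangian. -/
lemma isErgodicConstant_iff (hL : LagrangianAssumptions L) {lam : ℝ} :
    IsErgodicConstant L F m i lam ↔ ∃ z : Torus d → ℝ, Continuous z ∧
      IsViscositySolution (hamiltonian (playerLagrangian L F m i)) (fun _ => -lam) z := by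
  have e1 : ∀ x p, hamiltonian (L i) x p + lam ≤ meanCoupling F i m x ↔
      hamiltonian (playerLagrangian L F m i) x p ≤ -lam := fun x p => by
    rw [hamiltonian_playerLagrangian hL]; constructor <;> intro h <;> linarith
  have e2 : ∀ x p, meanCoupling F i m x ≤ hamiltonian (L i) x p + lam ↔
      -lam ≤ hamiltonian (playerLagrangian L F m i) x p := fun x p => by
    rw [hamiltonian_playerLagrangian hL]; constructor <;> intro h <;> linarith
  simp only [IsErgodicConstant, IsViscositySolution, e1, e2]

end

end ErgodicGame

end

theorem corollary4p2 {N d : ℕ}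
    (L : Fin N → ErgodicGame.Torus d → ErgodicGame.E d → ℝ)
    (F : Fin N → (Fin N → ErgodicGame.Torus d) → ℝ)
    (hL : ErgodicGame.LagrangianAssumptions L)
    (hF : ∀ i, Continuous (F i))
    (μ : Fin N → MeasureTheory.ProbabilityMeasure (ErgodicGame.Phase d))
    (hμ : ErgodicGame.IsMixedNash L F μ) (i : Fin N) :
    (∃! lam : ℝ,
      ErgodicGame.IsErgodicConstant L F (fun j => ErgodicGame.marginal (μ j)) i lam) ∧
    ∀ lam : ℝ,
      ErgodicGame.IsErgodicConstant L F (fun j => ErgodicGame.marginal (μ j)) i lam →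
        ErgodicGame.payoff L F i μ μ = (lam : EReal) := by
  open ErgodicGame in
  obtain ⟨Φ, hΦ, -⟩ := hμ.1 i
  obtain ⟨c, A, hℓ⟩ := isConvexLagrangian_playerLagrangian hL hΦ.contDiff
  obtain ⟨B, R, lam', w, σ, lam₀, u, D⟩ := exists_discreteApproximation hℓ
  have hex : IsErgodicConstant L F (fun j => marginal (μ j)) i lam₀ :=
    (isErgodicConstant_iff hL).2 ⟨u, D.continuous, D.isViscositySolution hℓ⟩
  have huniq : ∀ lam, IsErgodicConstant L F (fun j => marginal (μ j)) i lam → lam = lam₀ := by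
    intro lam hlam
    obtain ⟨z, hz, hz'⟩ := (isErgodicConstant_iff hL).1 hlam
    exact le_antisymm
      (ergodic_comparison hℓ hz D.continuous hz' (D.isViscositySolution hℓ))
      (ergodic_comparison hℓ D.continuous hz (D.isViscositySolution hℓ) hz')
  refine ⟨⟨lam₀, hex, huniq⟩, fun lam hlam => ?_⟩
  rw [huniq lam hlam]
  refine le_antisymm ?_ (D.le_extIntegral hℓ (hμ.1 i))
  obtain ⟨ν, hν, hνe⟩ := D.exists_minimizing_measure hℓ hΦ
  have h1 := hμ.2 i ν hν
  rw [← hνe]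
  simpa only [payoff, Function.update_self] using h1
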